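/- Let $K$ be a field. A weighted oriented graph $D$ consists of a finite simple graph $H$ (its underlying graph), a choice of exactly one direction for each edge of $H$, and a weight function $w:V(H)\to\{1,2,3,\dots\}$; write $(x,y)\in E(D)$ for an edge directed from $x$ to $y$. Assume, as is customary, that every source (a non-isolated vertex all of whose edges are directed away from it) has weight $1$; this does not affect the ideal below. The edge ideal of $D$ is $$I(D)=\langle\, x\,y^{w(y)} : (x,y)\in E(D)\,\rangle\subseteq A=K[V(H)],$$ and $I(H)=\langle xy : \{x,y\}\in E(H)\rangle$. An ideal $I\subseteq A$ is called Cohen–Macaulay if the ring $A/I$ is Cohen–Macaulay, and unmixed if all associated primes of $A/I$ have the same height. Let $x_1x_2x_3x_4x_5x_1$ be a $5$-cycle. Define the following families of weighted oriented $5$-cycles, where edges whose direction is not specified may be directed either way: - $D_1$: $(x_4,x_3),(x_4,x_5),(x_3,x_2),(x_5,x_1)$ are edges; $w(x_1)=w(x_2)=w(x_4)=1$, $w(x_3)\ne1$, $w(x_5)\neq 1$. - $D_2$: $(x_1,x_5),(x_5,x_4),(x_4,x_3)$ are edges; $w(x_1)=w(x_2)=w(x_3)=1$, $w(x_4)\ne1$,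 $w(x_5)\neq 1$. - $D_3$: $(x_1,x_5),(x_5,x_4),(x_4,x_3)$ are edges; $w(x_1)=w(x_2)=1$, $w(x_3)\ne1$, $w(x_4)\ne1$, $w(x_5)\neq 1$. - $D_4$: $(x_1,x_2),(x_2,x_3),(x_4,x_3),(x_4,x_5)$ are edges; $w(x_1)=w(x_4)=1$, $w(x_2)\ne1$, $w(x_3)\ne1$, $w(x_5)\neq 1$. **Theorem.** Let $D_H$ be a weighted oriented graph whose underlying graph $H$ is isomorphic to the $5$-cycle $C_5$. Then $I(D_H)$ is Cohen–Macaulay if and only if - $D_H$ is isomorphic to a member of $D_4$, or - there is $(x,y)\in E(D_H)$ with $w(x)=w(y)=1$, and $D_H$ is not isomorphic to a member of $D_1$, $D_2$ or $D_3$. Moreover, $I(D_H)$ is Cohen–Macaulay if and only if $I(D_H)$ is unmixed and $I(H)$ is Cohen–Macaulay. -/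

import Mathlib

/-- A weighted oriented graph on the vertex set `V`: an orientation of a simple graph
(each edge gets exactly one direction) together with positive integer vertex weights.
`D.Arc x y` says that `(x, y)` is an edge, directed from `x` to `y`. -/
structure WeightedOrientedGraph (V : Type*) where
  Arc : V → V → Prop
  asymm : ∀ x y, Arc x y → ¬ Arc y x
  weight : V → ℕ
  weight_pos : ∀ x, 0 < weight x

namespace WeightedOrientedGraph

variable {V : Type*}

/-- The underlying simple graph. -/
def underlying (D : WeightedOrientedGraph V) : SimpleGraph V where
  Adj x y := D.Arc x y ∨ D.Arc y x
  symm := ⟨fun _ _ h => h.symm⟩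
  loopless := ⟨fun x h => h.elim (fun h' => D.asymm x x h' h') (fun h' => D.asymm x x h' h')⟩

/-- A source: a non-isolated vertex all of whose incident edges are directed away from it. -/
def IsSource (D : WeightedOrientedGraph V) (v : V) : Prop :=
  (∃ u, D.underlying.Adj u v) ∧ ∀ u, D.underlying.Adj u v → D.Arc v u

/-- The edge ideal `⟨x y ^ w(y) : (x, y) an edge⟩` in `K[V]`. -/
noncomputable def edgeIdeal (D : WeightedOrientedGraph V) (K : Type*) [Field K] : Ideal (MvPolynomial V K) :=
  Ideal.span {f | ∃ x y, D.Arc x y ∧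
    f = MvPolynomial.X x * MvPolynomial.X y ^ D.weight y}

/-- `D` is isomorphic to a member of the family `D₁`. Here and below the vertices
`x₁, …, x₅` in cyclic order are `x 0, …, x 4`; edges of the 5-cycle whose direction is not
listed may be directed either way. -/
def IsD1 (D : WeightedOrientedGraph V) : Prop :=
  ∃ x : SimpleGraph.cycleGraph 5 ≃g D.underlying,
    D.Arc (x 3) (x 2) ∧ D.Arc (x 3) (x 4) ∧ D.Arc (x 2) (x 1) ∧ D.Arc (x 4) (x 0) ∧
    D.weight (x 0) = 1 ∧ D.weight (x 1) = 1 ∧ D.weight (x 2) ≠ 1 ∧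
    D.weight (x 3) = 1 ∧ D.weight (x 4) ≠ 1

/-- `D` is isomorphic to a member of the family `D₂`. -/
def IsD2 (D : WeightedOrientedGraph V) : Prop :=
  ∃ x : SimpleGraph.cycleGraph 5 ≃g D.underlying,
    D.Arc (x 0) (x 4) ∧ D.Arc (x 4) (x 3) ∧ D.Arc (x 3) (x 2) ∧
    D.weight (x 0) = 1 ∧ D.weight (x 1) = 1 ∧ D.weight (x 2) = 1 ∧
    D.weight (x 3) ≠ 1 ∧ D.weight (x 4) ≠ 1

/-- `D` is isomorphic to a member of the family `D₃`. -/
def IsD3 (D : WeightedOrientedGraph V) : Prop :=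
  ∃ x : SimpleGraph.cycleGraph 5 ≃g D.underlying,
    D.Arc (x 0) (x 4) ∧ D.Arc (x 4) (x 3) ∧ D.Arc (x 3) (x 2) ∧
    D.weight (x 0) = 1 ∧ D.weight (x 1) = 1 ∧ D.weight (x 2) ≠ 1 ∧
    D.weight (x 3) ≠ 1 ∧ D.weight (x 4) ≠ 1

/-- `D` is isomorphic to a member of the family `D₄`. -/
def IsD4 (D : WeightedOrientedGraph V) : Prop :=
  ∃ x : SimpleGraph.cycleGraph 5 ≃g D.underlying,
    D.Arc (x 0) (x 1) ∧ D.Arc (x 1) (x 2) ∧ D.Arc (x 3) (x 2) ∧ D.Arc (x 3) (x 4) ∧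
    D.weight (x 0) = 1 ∧ D.weight (x 1) ≠ 1 ∧ D.weight (x 2) ≠ 1 ∧
    D.weight (x 3) = 1 ∧ D.weight (x 4) ≠ 1

end WeightedOrientedGraph

/-- The edge ideal `⟨x y : {x, y} an edge⟩` of a simple graph. -/
noncomputable def SimpleGraph.edgeIdeal {V : Type*} (G : SimpleGraph V) (K : Type*) [Field K] :
    Ideal (MvPolynomial V K) :=
  Ideal.span {f | ∃ x y, G.Adj x y ∧ f = MvPolynomial.X x * MvPolynomial.X y}

/-- The depth of a local ring: the supremum of the lengths of the regular sequences
contained in its maximal ideal. -/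
noncomputable def IsLocalRing.depth (R : Type*) [CommRing R] [IsLocalRing R] : ℕ∞ :=
  ⨆ rs : {rs : List R //
    (∀ r ∈ rs, r ∈ IsLocalRing.maximalIdeal R) ∧ RingTheory.Sequence.IsRegular R rs},
    (rs.1.length : ℕ∞)

/-- A Cohen–Macaulay ring: a Noetherian ring whose localization at each maximal ideal has
depth equal to its Krull dimension. -/
def IsCohenMacaulayRing (R : Type*) [CommRing R] : Prop :=
  IsNoetherianRing R ∧ ∀ (m : Ideal R) [m.IsMaximal],
    (IsLocalRing.depth (Localization.AtPrime m) : WithBot ℕ∞) =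
      ringKrullDim (Localization.AtPrime m)

/-- An ideal `I` is Cohen–Macaulay if the quotient ring by `I` is. -/
def Ideal.IsCohenMacaulay {R : Type*} [CommRing R] (I : Ideal R) : Prop :=
  IsCohenMacaulayRing (R ⧸ I)

/-- An ideal `I` is unmixed if all associated primes of `R ⧸ I` have the same height. -/
def Ideal.IsUnmixed {R : Type*} [CommRing R] (I : Ideal R) : Prop :=
  ∀ P ∈ associatedPrimes R (R ⧸ I), ∀ Q ∈ associatedPrimes R (R ⧸ I), P.height = Q.height

/-!
Call a vertex a *flow-through* vertex if it has weight at least two and an out-arc. Since sources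
have weight one, these are the vertices occurring with two different exponents in the generators of
the edge ideal `I`. The ideal is Cohen–Macaulay, and equally unmixed, exactly if no two
flow-through vertices are adjacent or are out-neighbours of a common vertex
(`WeightedOrientedGraph.FlowSeparated`); the families in the statement are the translation of this.

If the flow-through vertices are separated, the cycle can be labelled so that they lie among the
two neighbours of `x 0`, not both fed by `x 0`. Then `A ⧸ I` has a filtration whose factors are
`A ⧸ P` for the five minimal primes `P` of the 5-cycle (`HasCleanFiltration`), obtained by splitting
off powers of variables one at a time (`CleanExponents.pentagon`). So all associated primes are
minimal, of equal height. Properly 3-colouring the 5-cycle formed by the five independent pairs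
with the vectors `(1, 0)`, `(0, 1)`, `(1, 1)` gives two linear forms that are coordinates on
each of the planes `A ⧸ P`, over any field. At a maximal ideal, monic polynomials in these forms,
vanishing there, are a regular sequence on every `A ⧸ P`, hence on `A ⧸ I`, and the quotient has
dimension zero; thus depth and dimension are both two.

If the flow-through vertices are not separated, an explicit monomial has as annihilator modulo `I`
the prime ideal of a coordinate axis, which strictly contains a minimal prime. So `I` is not unmixed
(`Ideal.not_isUnmixed_of_colon`), and at the origin `A ⧸ I` has dimension at least two and depth at
most one (`Ideal.not_isCohenMacaulay_of_colon`).
-/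

/-! ### Clean filtrations and regular sequences -/

section CleanFiltration

variable {A : Type*} [CommRing A]

/-- `HasCleanFiltration S J` says that `A ⧸ J` has a finite filtration all of whose factors are
of the form `A ⧸ P` with `P ∈ S`. It is encoded through the exact sequences
`0 → A ⧸ (J : f) → A ⧸ J → A ⧸ (J + (f)) → 0`, the ideal `J'` below being `J : f`. -/
inductive HasCleanFiltration (S : Set (Ideal A)) : Ideal A → Prop
  | of_mem {P : Ideal A} : P ∈ S → HasCleanFiltration S P
  | step {J J' : Ideal A} (f : A) : (∀ h, h * f ∈ J ↔ h ∈ J') → HasCleanFiltration S J' →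
      HasCleanFiltration S (J ⊔ Ideal.span {f}) → HasCleanFiltration S J

/-- The pair `a, b` is a weakly regular sequence on `A ⧸ J`. -/
def IsRegularPair (a b : A) (J : Ideal A) : Prop :=
  (∀ f, a * f ∈ J → f ∈ J) ∧
    ∀ g, b * g ∈ J ⊔ Ideal.span {a} → g ∈ J ⊔ Ideal.span {a}

lemma Ideal.mem_sup_span_singleton_iff {J : Ideal A} {a g : A} :
    g ∈ J ⊔ Ideal.span {a} ↔ ∃ j ∈ J, ∃ k, g = j + k * a := by
  simp only [Submodule.mem_sup, Ideal.mem_span_singleton']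
  constructor
  · rintro ⟨j, hj, _, ⟨k, rfl⟩, rfl⟩; exact ⟨j, hj, k, rfl⟩
  · rintro ⟨j, hj, k, rfl⟩; exact ⟨j, hj, _, ⟨k, rfl⟩, rfl⟩

namespace HasCleanFiltration

variable {S : Set (Ideal A)} {J : Ideal A}

lemma isRegularPair {a b : A} (hJ : HasCleanFiltration S J)
    (h : ∀ P ∈ S, IsRegularPair a b P) : IsRegularPair a b J := by
  induction hJ with
  | of_mem hP => exact h _ hP
  | @step J J' f hf _ _ ih₁ ih₂ =>
    have hle : J ≤ J ⊔ Ideal.span {f} := le_sup_left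
    have h₁ : ∀ g, a * g ∈ J → g ∈ J := by
      intro g hg
      obtain ⟨j, hj, k, rfl⟩ := Ideal.mem_sup_span_singleton_iff.1 (ih₂.1 g (hle hg))
      have : a * k * f ∈ J := by
        rw [show a * k * f = a * (j + k * f) - a * j by ring]
        exact J.sub_mem hg (J.mul_mem_left a hj)
      exact J.add_mem hj ((hf k).2 (ih₁.1 k ((hf _).1 this)))
    refine ⟨h₁, fun g hg => ?_⟩
    have hle' : J ⊔ Ideal.span {a} ≤ J ⊔ Ideal.span {f} ⊔ Ideal.span {a} :=
      sup_le_sup_right hle _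
    obtain ⟨j₀, hj₀, k, hg'⟩ := Ideal.mem_sup_span_singleton_iff.1 (ih₂.2 g (hle' hg))
    obtain ⟨j, hj, h', rfl⟩ := Ideal.mem_sup_span_singleton_iff.1 hj₀
    subst hg'
    obtain ⟨j', hj', l, hl⟩ := Ideal.mem_sup_span_singleton_iff.1 hg
    -- `b h' f` is congruent to `(l - b k) a` modulo `J`, and `a` is regular modulo `J + (f)`,
    -- so `l - b k` is a multiple of `f` modulo `J`
    have hl' : a * (l - b * k) ∈ J ⊔ Ideal.span {f} := by
      refine Ideal.mem_sup_span_singleton_iff.2 ⟨b * j - j', J.sub_mem (J.mul_mem_left _ hj) hj',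
        b * h', ?_⟩
      linear_combination -hl
    obtain ⟨j'', hj'', l', hl''⟩ := Ideal.mem_sup_span_singleton_iff.1 (ih₂.1 _ hl')
    have hJ' : (b * h' - a * l') ∈ J' := by
      refine (hf _).1 ?_
      have : (b * h' - a * l') * f = j' - b * j + a * j'' := by
        linear_combination hl + a * hl''
      rw [this]
      exact J.add_mem (J.sub_mem hj' (J.mul_mem_left _ hj)) (J.mul_mem_left _ hj'')
    obtain ⟨j₃, hj₃, k₃, hk₃⟩ := Ideal.mem_sup_span_singleton_iff.1
      (ih₁.2 h' (Ideal.mem_sup_span_singleton_iff.2 ⟨_, hJ', l', by ring⟩))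
    refine Ideal.mem_sup_span_singleton_iff.2
      ⟨j + j₃ * f, J.add_mem hj ((hf _).2 hj₃), k + k₃ * f, ?_⟩
    rw [hk₃]; ring

/-- A prime containing `J` contains one of the primes occurring in a clean filtration. -/
lemma exists_le_of_isPrime (hJ : HasCleanFiltration S J) {Q : Ideal A} (hQ : Q.IsPrime)
    (hle : J ≤ Q) : ∃ P ∈ S, P ≤ Q := by
  induction hJ with
  | of_mem hP => exact ⟨_, hP, hle⟩
  | @step J J' f hf _ _ ih₁ ih₂ =>
    by_cases hfQ : f ∈ Q
    · exact ih₂ (sup_le hle ((Ideal.span_singleton_le_iff_mem _).2 hfQ))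
    · exact ih₁ fun h hh => (hQ.mem_or_mem (hle ((hf h).2 hh))).resolve_right hfQ

lemma mem_of_colon_eq (hJ : HasCleanFiltration S J) (hS : ∀ P ∈ S, P.IsPrime) {Q : Ideal A}
    (hQ : Q.IsPrime) (y : A) (hy : ∀ g, g * y ∈ J ↔ g ∈ Q) : Q ∈ S := by
  induction hJ generalizing y with
  | @of_mem P hP =>
    have hyP : y ∉ P := fun h =>
      hQ.ne_top ((Ideal.eq_top_iff_one _).2 ((hy 1).1 (by simpa using h)))
    convert hP
    ext g
    rw [← hy]
    exact ⟨fun h => ((hS P hP).mem_or_mem h).resolve_right hyP, fun h => P.mul_mem_right _ h⟩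
  | @step J J' f hf _ _ ih₁ ih₂ =>
    by_cases hex : ∃ g ∉ Q, g * y ∈ J ⊔ Ideal.span {f}
    · obtain ⟨g, hg, hgy⟩ := hex
      obtain ⟨j, hj, k, hk⟩ := Ideal.mem_sup_span_singleton_iff.1 hgy
      refine ih₁ k fun h => ?_
      rw [← hf, mul_assoc, show k * f = g * y - j by rw [hk]; ring, mul_sub,
        J.sub_mem_iff_left (J.mul_mem_left _ hj), ← mul_assoc, hy]
      exact ⟨fun h => (hQ.mem_or_mem h).resolve_right hg, fun h => Q.mul_mem_right _ h⟩
    · push Not at hex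
      refine ih₂ y fun g => ⟨fun h => by_contra fun hg => hex g hg h, fun h => ?_⟩
      exact le_sup_left (a := J) ((hy g).2 h)

/-- The associated primes of `A ⧸ J` occur in every clean filtration. -/
lemma associatedPrimes_subset [IsNoetherianRing A] (hJ : HasCleanFiltration S J)
    (hS : ∀ P ∈ S, P.IsPrime) : associatedPrimes A (A ⧸ J) ⊆ S := by
  intro Q hQ
  obtain ⟨hQ, y, rfl⟩ := isAssociatedPrime_iff.1 hQ
  obtain ⟨y, rfl⟩ := Ideal.Quotient.mk_surjective y
  refine hJ.mem_of_colon_eq hS hQ y fun g => ?_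
  rw [Submodule.mem_colon_singleton, Submodule.mem_bot, ← Ideal.Quotient.eq_zero_iff_mem, map_mul]
  rfl

end HasCleanFiltration

/-- A regular pair on `A ⧸ J` is a weakly regular sequence in the ring `A ⧸ J`. -/
lemma IsRegularPair.isWeaklyRegular {a b : A} {J : Ideal A} (h : IsRegularPair a b J) :
    RingTheory.Sequence.IsWeaklyRegular (A ⧸ J)
      [Ideal.Quotient.mk J a, Ideal.Quotient.mk J b] := by
  rw [RingTheory.Sequence.isWeaklyRegular_cons_iff,
    RingTheory.Sequence.isWeaklyRegular_singleton_iff]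
  refine ⟨?_, ?_⟩
  · rw [isSMulRegular_iff_right_eq_zero_of_smul]
    intro f
    obtain ⟨f, rfl⟩ := Ideal.Quotient.mk_surjective f
    rw [smul_eq_mul, ← map_mul, Ideal.Quotient.eq_zero_iff_mem, Ideal.Quotient.eq_zero_iff_mem]
    exact h.1 f
  · have key : ∀ g : A, (Submodule.Quotient.mk (Ideal.Quotient.mk J g) :
        QuotSMulTop (Ideal.Quotient.mk J a) (A ⧸ J)) = 0 ↔ g ∈ J ⊔ Ideal.span {a} := by
      intro g
      rw [Submodule.Quotient.mk_eq_zero, Submodule.mem_smul_pointwise_iff_exists,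
        Ideal.mem_sup_span_singleton_iff]
      constructor
      · rintro ⟨k, -, hk⟩
        obtain ⟨k, rfl⟩ := Ideal.Quotient.mk_surjective k
        rw [smul_eq_mul, ← map_mul, eq_comm, Ideal.Quotient.eq] at hk
        exact ⟨_, hk, k, by ring⟩
      · rintro ⟨j, hj, k, rfl⟩
        refine ⟨Ideal.Quotient.mk J k, trivial, ?_⟩
        rw [map_add, Ideal.Quotient.eq_zero_iff_mem.2 hj, zero_add, mul_comm, map_mul, smul_eq_mul]
    rw [isSMulRegular_iff_right_eq_zero_of_smul]
    intro g
    obtain ⟨g, rfl⟩ := Submodule.Quotient.mk_surjective _ g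
    obtain ⟨g, rfl⟩ := Ideal.Quotient.mk_surjective g
    rw [← Submodule.Quotient.mk_smul, smul_eq_mul, ← map_mul, key, key]
    exact h.2 g

/-- A Noetherian ring in which every maximal ideal contains a weakly regular sequence of length
two generating an ideal over which it is minimal is Cohen–Macaulay. -/
lemma IsCohenMacaulayRing.of_forall_exists_pair {R : Type*} [CommRing R] [IsNoetherianRing R]
    (h : ∀ m : Ideal R, m.IsMaximal → ∃ a b : R,
      RingTheory.Sequence.IsWeaklyRegular R [a, b] ∧ m ∈ (Ideal.span {a, b}).minimalPrimes) :
    IsCohenMacaulayRing R := by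
  refine ⟨inferInstance, fun m hm => ?_⟩
  obtain ⟨a, b, hab, hmin⟩ := h m hm
  have hmem : ∀ r ∈ [a, b], r ∈ m := by
    intro r hr
    exact hmin.1.2 (Ideal.subset_span (by simpa using hr))
  have hreg := hab.isRegular_of_isLocalization_of_mem (Localization.AtPrime m) m hmem
  have hle : ∀ rs : List (Localization.AtPrime m),
      RingTheory.Sequence.IsRegular (Localization.AtPrime m) rs →
      ((rs.length : ℕ∞) : WithBot ℕ∞) ≤ ringKrullDim (Localization.AtPrime m) := by
    intro rs hrs
    rw [← ringKrullDim_add_length_eq_ringKrullDim_of_isRegular rs hrs]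
    have : Nontrivial (Localization.AtPrime m ⧸ Ideal.ofList rs) := by
      refine Ideal.Quotient.nontrivial_iff.2 fun h => hrs.2 ?_
      rw [h, Submodule.top_smul]
    refine le_add_of_nonneg_left ringKrullDim_nonneg_of_nontrivial
  have hdim : ringKrullDim (Localization.AtPrime m) ≤ ((2 : ℕ∞) : WithBot ℕ∞) := by
    rw [IsLocalization.AtPrime.ringKrullDim_eq_height m]
    norm_cast
    refine (Ideal.height_le_card_of_mem_minimalPrimes_span (by simp) hmin).trans ?_
    exact_mod_cast (Set.ncard_insert_le a {b}).trans (by simp)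
  apply le_antisymm
  · obtain ⟨n, hn⟩ : ∃ n : ℕ∞, ringKrullDim (Localization.AtPrime m) = n := by
      rw [IsLocalization.AtPrime.ringKrullDim_eq_height m]; exact ⟨_, rfl⟩
    rw [hn]
    refine WithBot.coe_le_coe.2 (iSup_le fun rs => ?_)
    have := hle rs.1 rs.2.2
    rw [hn] at this
    exact WithBot.coe_le_coe.1 this
  · refine hdim.trans (WithBot.coe_le_coe.2 ?_)
    refine le_iSup_of_le ⟨_, ?_, hreg⟩ ?_
    · intro r hr
      obtain ⟨s, hs, rfl⟩ := List.mem_map.1 hr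
      exact (IsLocalization.AtPrime.to_map_mem_maximal_iff _ m s).2 (hmem s hs)
    · simp

end CleanFiltration

/-! ### Ideals generated by variables -/

section VariableIdeals

open MvPolynomial

variable {V K : Type*} [Field K]

/-- Setting the variables in `C` to zero has kernel the ideal generated by these variables. -/
lemma MvPolynomial.ker_aeval_ite (C : Set V) [DecidablePred (· ∈ C)] :
    RingHom.ker (aeval fun v => if v ∈ C then 0 else X v : MvPolynomial V K →ₐ[K] MvPolynomial V K)
      = Ideal.span (X '' C) := by
  apply le_antisymm
  · intro f hf
    have key : (Ideal.Quotient.mkₐ K (Ideal.span (X '' C : Set (MvPolynomial V K)))).comp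
        (aeval fun v => if v ∈ C then 0 else X v) = Ideal.Quotient.mkₐ K _ := by
      refine MvPolynomial.algHom_ext fun v => ?_
      by_cases hv : v ∈ C
      · simp only [AlgHom.comp_apply, aeval_X, if_pos hv, map_zero]
        have : (X v : MvPolynomial V K) ∈ Ideal.span (X '' C) := Ideal.subset_span ⟨v, hv, rfl⟩
        exact (Ideal.Quotient.eq_zero_iff_mem.2 this).symm
      · simp [hv]
    have := AlgHom.congr_fun key f
    rw [AlgHom.comp_apply, (RingHom.mem_ker).1 hf, map_zero] at this
    exact Ideal.Quotient.eq_zero_iff_mem.1 this.symm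
  · rw [Ideal.span_le]
    rintro _ ⟨v, hv, rfl⟩
    simp [hv]

lemma MvPolynomial.isPrime_span_X_image (C : Set V) :
    (Ideal.span (X '' C : Set (MvPolynomial V K))).IsPrime := by
  classical
  rw [← ker_aeval_ite C]
  exact RingHom.ker_isPrime _

lemma MvPolynomial.X_mem_span_X_image {C : Set V} {v : V} :
    (X v : MvPolynomial V K) ∈ Ideal.span (X '' C) ↔ v ∈ C := by
  refine ⟨fun h => ?_, fun h => Ideal.subset_span ⟨v, h, rfl⟩⟩
  obtain ⟨i, hi, h⟩ := mem_ideal_span_X_image.1 h (Finsupp.single v 1) (by simp [support_X])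
  by_cases hvi : v = i
  · exact hvi ▸ hi
  · simp [hvi] at h

end VariableIdeals

/-! ### The minimal primes of the 5-cycle and their linear parameters -/

section FiveCycle

open MvPolynomial

variable {V K : Type*} [Field K]

variable (K) in
/-- For a cyclic labelling `x` of the vertices of a 5-cycle, the prime ideal generated by the
variables outside the independent set `{x k, x (k + 2)}`. These are the minimal primes of the edge
ideal of the 5-cycle. -/
noncomputable def coverIdeal (x : Fin 5 ≃ V) (k : Fin 5) : Ideal (MvPolynomial V K) :=
  Ideal.span (X '' {v | v ≠ x k ∧ v ≠ x (k + 2)})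

instance (x : Fin 5 ≃ V) (k : Fin 5) : (coverIdeal K x k).IsPrime :=
  isPrime_span_X_image _

lemma height_coverIdeal_add (x : Fin 5 ≃ V) (k j : Fin 5) :
    (coverIdeal K x (k + j)).height = (coverIdeal K x k).height := by
  -- the cyclic rotation of the variables by `j` maps one ideal to the other
  let e : V ≃ V := (x.symm.trans (Equiv.addRight j)).trans x
  rw [← RingEquiv.height_map (renameEquiv K e).toRingEquiv (coverIdeal K x k)]
  congr 1
  rw [coverIdeal, coverIdeal, Ideal.map_span, Set.image_image]
  congr 1
  ext f
  simp only [Set.mem_image, Set.mem_ofPred_eq]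
  constructor
  · rintro ⟨v, ⟨h₁, h₂⟩, rfl⟩
    refine ⟨e.symm v, ⟨?_, ?_⟩, ?_⟩
    · rw [Ne, Equiv.symm_apply_eq]; simpa [e] using h₁
    · rw [Ne, Equiv.symm_apply_eq]; simpa [e, add_right_comm] using h₂
    · simp
  · rintro ⟨v, ⟨h₁, h₂⟩, rfl⟩
    refine ⟨e v, ⟨?_, ?_⟩, ?_⟩
    · rw [Ne, ← Equiv.eq_symm_apply]; simpa [e] using h₁
    · rw [Ne, ← Equiv.eq_symm_apply]; simpa [e, add_right_comm] using h₂
    · simp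

lemma height_coverIdeal_eq (x : Fin 5 ≃ V) (k l : Fin 5) :
    (coverIdeal K x k).height = (coverIdeal K x l).height := by
  rw [← height_coverIdeal_add x l (k - l), add_sub_cancel]

variable (K) in
/-- The first of two linear forms which restrict to coordinates on each of the five planes
`coverIdeal K x k = 0`: colour the 5-cycle `0, 2, 4, 1, 3` properly with the three vectors
`(1, 0)`, `(0, 1)`, `(1, 1)`, which are pairwise independent over every field. -/
noncomputable def linFormU (x : Fin 5 ≃ V) : MvPolynomial V K := X (x 0) + X (x 3) + X (x 4)

variable (K) in
/-- The second of the two linear forms, see `linFormU`. -/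
noncomputable def linFormV (x : Fin 5 ≃ V) : MvPolynomial V K := X (x 1) + X (x 2) + X (x 3)

variable (K) in
/-- The values of the five variables in terms of the two linear forms `U = C X` and `V = X`
on the plane `coverIdeal K x k = 0`. -/
noncomputable def planeCoord (k : Fin 5) : Fin 5 → Polynomial (Polynomial K) :=
  let U : Polynomial (Polynomial K) := Polynomial.C Polynomial.X
  let W : Polynomial (Polynomial K) := Polynomial.X
  match k with
  | 0 => ![U, 0, W, 0, 0]
  | 1 => ![0, W - U, 0, U, 0]
  | 2 => ![0, 0, W, 0, U]
  | 3 => ![U - W, 0, 0, W, 0]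
  | 4 => ![0, W, 0, 0, U]

variable (K) in
/-- The parametrization of the plane `coverIdeal K x k = 0` by the two linear forms. -/
noncomputable def planeMap (x : Fin 5 ≃ V) (k : Fin 5) :
    MvPolynomial V K →ₐ[K] Polynomial (Polynomial K) :=
  aeval fun v => planeCoord K k (x.symm v)

variable (K) in
/-- The inclusion of the polynomial ring in the two linear forms, a section of `planeMap`. -/
noncomputable def planeSection (x : Fin 5 ≃ V) :
    Polynomial (Polynomial K) →+* MvPolynomial V K :=
  Polynomial.eval₂RingHom (Polynomial.aeval (linFormU K x)).toRingHom (linFormV K x)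

lemma planeMap_linFormU (x : Fin 5 ≃ V) (k : Fin 5) :
    planeMap K x k (linFormU K x) = Polynomial.C Polynomial.X := by
  fin_cases k <;> simp [planeMap, linFormU, planeCoord]

lemma planeMap_linFormV (x : Fin 5 ≃ V) (k : Fin 5) :
    planeMap K x k (linFormV K x) = Polynomial.X := by
  fin_cases k <;> simp [planeMap, linFormV, planeCoord]

lemma planeMap_planeSection (x : Fin 5 ≃ V) (k : Fin 5) (g : Polynomial (Polynomial K)) :
    planeMap K x k (planeSection K x g) = g := by
  have : (planeMap K x k).toRingHom.comp (planeSection K x) = RingHom.id _ := by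
    refine Polynomial.ringHom_ext' (Polynomial.ringHom_ext' ?_ ?_) ?_
    · ext a
      simp [planeSection]
    · simp [planeSection, planeMap_linFormU]
    · simp [planeSection, planeMap_linFormV]
  exact DFunLike.congr_fun this g

lemma mk_planeSection_planeCoord (x : Fin 5 ≃ V) (k j : Fin 5) :
    Ideal.Quotient.mk (coverIdeal K x k) (planeSection K x (planeCoord K k j)) =
      Ideal.Quotient.mk (coverIdeal K x k) (X (x j)) := by
  have h : ∀ i, i ≠ k → i ≠ k + 2 → Ideal.Quotient.mk (coverIdeal K x k) (X (x i)) = 0 :=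
    fun i h₁ h₂ => Ideal.Quotient.eq_zero_iff_mem.2
      (Ideal.subset_span ⟨x i, ⟨x.injective.ne h₁, x.injective.ne h₂⟩, rfl⟩)
  have hU : planeSection K x (Polynomial.C Polynomial.X) = linFormU K x := by simp [planeSection]
  have hV : planeSection K x Polynomial.X = linFormV K x := by simp [planeSection]
  have h0 := h 0
  have h1 := h 1
  have h2 := h 2
  have h3 := h 3
  have h4 := h 4
  fin_cases k <;> simp at h0 h1 h2 h3 h4 <;> fin_cases j <;>
    simp [planeCoord, hU, hV, linFormU, linFormV, h0, h1, h2, h3, h4]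

lemma ker_planeMap (x : Fin 5 ≃ V) (k : Fin 5) :
    RingHom.ker (planeMap K x k) = coverIdeal K x k := by
  apply le_antisymm
  · intro f hf
    have key : ∀ f, Ideal.Quotient.mk (coverIdeal K x k) (planeSection K x (planeMap K x k f)) =
        Ideal.Quotient.mk (coverIdeal K x k) f := by
      intro f
      induction f using MvPolynomial.induction_on with
      | C a => simp [planeMap, planeSection]
      | add f g hf hg => simp only [map_add, hf, hg]
      | mul_X f v hf =>
        rw [map_mul, map_mul, map_mul, hf, map_mul]
        congr 1
        have := mk_planeSection_planeCoord (K := K) x k (x.symm v)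
        rw [x.apply_symm_apply] at this
        rw [← this, planeMap, aeval_X]
    rw [← Ideal.Quotient.eq_zero_iff_mem, ← key, (RingHom.mem_ker).1 hf, map_zero, map_zero]
  · rw [coverIdeal, Ideal.span_le]
    rintro _ ⟨v, ⟨h₁, h₂⟩, rfl⟩
    obtain ⟨j, rfl⟩ := x.surjective v
    rw [x.injective.ne_iff] at h₁ h₂
    simp only [SetLike.mem_coe, RingHom.mem_ker, planeMap, aeval_X, Equiv.symm_apply_apply]
    revert h₁ h₂
    fin_cases k <;> fin_cases j <;> simp [planeCoord]

/-- If `q` is monic and `p` is a constant, `q` is regular modulo `p`. -/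
lemma Polynomial.Monic.C_dvd_of_C_dvd_mul {R : Type*} [CommRing R] {q g : Polynomial R} {p : R}
    (hq : q.Monic) (h : Polynomial.C p ∣ q * g) : Polynomial.C p ∣ g := by
  have key : ∀ f : Polynomial R, Polynomial.C p ∣ f ↔
      f.map (Ideal.Quotient.mk (Ideal.span {p})) = 0 := by
    intro f
    rw [Polynomial.C_dvd_iff_dvd_coeff, Polynomial.ext_iff]
    simp [Ideal.Quotient.eq_zero_iff_mem, Ideal.mem_span_singleton]
  rw [key, Polynomial.map_mul, (hq.map _).mul_right_eq_zero_iff] at h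
  exact (key g).2 h

lemma isRegularPair_coverIdeal (x : Fin 5 ≃ V) (k : Fin 5) {p q : Polynomial K} (hp : p.Monic)
    (hq : q.Monic) : IsRegularPair (Polynomial.aeval (linFormU K x) p)
      (Polynomial.aeval (linFormV K x) q) (coverIdeal K x k) := by
  have hmem : ∀ f, f ∈ coverIdeal K x k ↔ planeMap K x k f = 0 := fun f => by
    rw [← ker_planeMap]; rfl
  have hp' : planeMap K x k (Polynomial.aeval (linFormU K x) p) = Polynomial.C p := by
    rw [← Polynomial.aeval_algHom_apply, planeMap_linFormU]
    have := Polynomial.aeval_algHom_apply (Polynomial.CAlgHom (R := K) (A := Polynomial K))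
      Polynomial.X p
    rwa [Polynomial.aeval_X_left_apply] at this
  have hq' : planeMap K x k (Polynomial.aeval (linFormV K x) q) =
      q.map (algebraMap K (Polynomial K)) := by
    rw [← Polynomial.aeval_algHom_apply, planeMap_linFormV]
    exact Polynomial.aeval_X_left_eq_map q
  refine ⟨fun f hf => ?_, fun g hg => ?_⟩
  · rw [hmem, map_mul, hp'] at hf
    rw [hmem]
    exact (mul_eq_zero.1 hf).resolve_left (by simpa using hp.ne_zero)
  · obtain ⟨j, hj, l, hl⟩ := Ideal.mem_sup_span_singleton_iff.1 hg
    rw [hmem] at hj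
    have h := congrArg (planeMap K x k) hl
    rw [map_mul, map_add, hj, zero_add, map_mul, hp', hq'] at h
    obtain ⟨r, hr⟩ := (hq.map (algebraMap K (Polynomial K))).C_dvd_of_C_dvd_mul
      (Dvd.intro_left _ h.symm)
    refine Ideal.mem_sup_span_singleton_iff.2
      ⟨g - planeSection K x r * Polynomial.aeval (linFormU K x) p, ?_, planeSection K x r, by ring⟩
    rw [hmem, map_sub, map_mul, hr, hp', planeMap_planeSection, mul_comm, sub_self]

/-- A maximal ideal of a finitely generated `K`-algebra contains a monic polynomial in each given
element, by the Nullstellensatz. -/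
lemma exists_monic_aeval_mem {A : Type*} [CommRing A] [Algebra K A] [Algebra.FiniteType K A]
    (m : Ideal A) [m.IsMaximal] (u : A) :
    ∃ p : Polynomial K, p.Monic ∧ Polynomial.aeval u p ∈ m := by
  let := Ideal.Quotient.field m
  have : Module.Finite K (A ⧸ m) := finite_of_finite_type_of_isJacobsonRing K (A ⧸ m)
  obtain ⟨p, hp, h⟩ := Algebra.IsIntegral.isIntegral (R := K) (Ideal.Quotient.mkₐ K m u)
  refine ⟨p, hp, Ideal.Quotient.eq_zero_iff_mem.1 ?_⟩
  rw [← Ideal.Quotient.mkₐ_eq_mk K, ← Polynomial.aeval_algHom_apply]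
  exact h

/-- A prime of `K[V]` lying over a `coverIdeal` and containing monic polynomials in both linear
forms is maximal, because the residue ring is integral over `K`. -/
lemma isMaximal_of_monic_mem (x : Fin 5 ≃ V) (k : Fin 5) {p q : Polynomial K} (hp : p.Monic)
    (hq : q.Monic) {Q : Ideal (MvPolynomial V K)} [Q.IsPrime] (hk : coverIdeal K x k ≤ Q)
    (hpQ : Polynomial.aeval (linFormU K x) p ∈ Q) (hqQ : Polynomial.aeval (linFormV K x) q ∈ Q) :
    Q.IsMaximal := by
  have hint : ∀ (f : MvPolynomial V K) (p : Polynomial K), p.Monic → Polynomial.aeval f p ∈ Q →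
      IsIntegral K (Ideal.Quotient.mkₐ K Q f) := by
    intro f p hp h
    refine ⟨p, hp, ?_⟩
    rw [← Polynomial.aeval_def, Polynomial.aeval_algHom_apply]
    exact Ideal.Quotient.eq_zero_iff_mem.2 h
  have hU := hint _ p hp hpQ
  have hV := hint _ q hq hqQ
  have hX : ∀ j, IsIntegral K (Ideal.Quotient.mkₐ K Q (X (x j))) := by
    intro j
    have h := Ideal.Quotient.eq.2
      (hk (Ideal.Quotient.eq.1 (mk_planeSection_planeCoord (K := K) x k j)))
    rw [Ideal.Quotient.mkₐ_eq_mk, ← h]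
    have hU' : planeSection K x (Polynomial.C Polynomial.X) = linFormU K x := by simp [planeSection]
    have hV' : planeSection K x Polynomial.X = linFormV K x := by simp [planeSection]
    rw [Ideal.Quotient.mkₐ_eq_mk] at hU hV
    fin_cases k <;> fin_cases j <;>
      simp [planeCoord, hU', hV', hU, hV, isIntegral_zero, IsIntegral.sub]
  have hall : Algebra.IsIntegral K (MvPolynomial V K ⧸ Q) := by
    refine ⟨fun y => ?_⟩
    obtain ⟨f, rfl⟩ := Ideal.Quotient.mk_surjective y
    induction f using MvPolynomial.induction_on with
    | C a => exact isIntegral_algebraMap (R := K) (A := MvPolynomial V K ⧸ Q) (x := a)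
    | add f g hf hg => rw [map_add]; exact hf.add hg
    | mul_X f v hf =>
      rw [map_mul]
      obtain ⟨j, rfl⟩ := x.surjective v
      exact hf.mul (hX j)
  exact Ideal.Quotient.maximal_of_isField _
    (isField_of_isIntegral_of_isField' (Field.toIsField K))

/-- An ideal with a clean filtration by the minimal primes of the 5-cycle is Cohen–Macaulay. -/
lemma HasCleanFiltration.isCohenMacaulay {x : Fin 5 ≃ V} {J : Ideal (MvPolynomial V K)}
    (hJ : HasCleanFiltration (Set.range (coverIdeal K x)) J) : J.IsCohenMacaulay := by
  have : Finite V := Finite.of_equiv _ x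
  refine IsCohenMacaulayRing.of_forall_exists_pair fun m hm => ?_
  let M := m.comap (Ideal.Quotient.mk J)
  have hM : M.IsMaximal := Ideal.comap_isMaximal_of_surjective _ Ideal.Quotient.mk_surjective
  obtain ⟨p, hp, hpM⟩ := exists_monic_aeval_mem (K := K) M (linFormU K x)
  obtain ⟨q, hq, hqM⟩ := exists_monic_aeval_mem (K := K) M (linFormV K x)
  refine ⟨_, _, (hJ.isRegularPair (a := Polynomial.aeval (linFormU K x) p)
    (b := Polynomial.aeval (linFormV K x) q) ?_).isWeaklyRegular, ?_⟩
  · rintro _ ⟨k, rfl⟩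
    exact isRegularPair_coverIdeal x k hp hq
  refine ⟨⟨hm.isPrime, ?_⟩, fun Q ⟨hQ, hle⟩ hQm => ?_⟩
  · rw [Ideal.span_le]
    rintro _ (rfl | rfl)
    exacts [hpM, hqM]
  · have hpQ := hle (Ideal.subset_span (Set.mem_insert _ _))
    have hqQ := hle (Ideal.subset_span (Set.mem_insert_of_mem _ rfl))
    have hQ' : (Q.comap (Ideal.Quotient.mk J)).IsPrime := Ideal.comap_isPrime _ Q
    have hJQ : J ≤ Q.comap (Ideal.Quotient.mk J) := fun f hf => by
      rw [Ideal.mem_comap, Ideal.Quotient.eq_zero_iff_mem.2 hf]; exact Q.zero_mem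
    obtain ⟨_, ⟨k, rfl⟩, hk⟩ := hJ.exists_le_of_isPrime hQ' hJQ
    have hmax := isMaximal_of_monic_mem x k hp hq hk hpQ hqQ
    have heq := hmax.eq_of_le hM.ne_top (Ideal.comap_mono hQm)
    have := congrArg (Ideal.map (Ideal.Quotient.mk J)) heq
    rw [Ideal.map_comap_of_surjective _ Ideal.Quotient.mk_surjective,
      Ideal.map_comap_of_surjective _ Ideal.Quotient.mk_surjective] at this
    exact this.ge

lemma HasCleanFiltration.isUnmixed {x : Fin 5 ≃ V} {J : Ideal (MvPolynomial V K)}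
    (hJ : HasCleanFiltration (Set.range (coverIdeal K x)) J) : J.IsUnmixed := by
  have : Finite V := Finite.of_equiv _ x
  have hsub := hJ.associatedPrimes_subset (by rintro _ ⟨k, rfl⟩; infer_instance)
  intro P hP Q hQ
  obtain ⟨k, rfl⟩ := hsub hP
  obtain ⟨l, rfl⟩ := hsub hQ
  exact height_coverIdeal_eq x k l

end FiveCycle

/-! ### Embedded primes -/

section EmbeddedPrimes

/-- If the annihilator of a nonzero element `y` of a Noetherian local ring becomes primary to the
maximal ideal as soon as a nonzerodivisor is added, then there is no regular sequence of length
two. Dividing `y` by the first element `r` of such a sequence as often as possible gives a nonzero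
element modulo `r` killed by a power of the maximal ideal. -/
lemma IsLocalRing.not_isSMulRegular_of_colon {S : Type*} [CommRing S] [IsLocalRing S]
    [IsNoetherianRing S] {y : S} (hy : y ≠ 0)
    (h : ∀ Q : Ideal S, Q.IsPrime → (∀ g, g * y = 0 → g ∈ Q) → ∀ r ∈ Q, r * y ≠ 0 →
      Q = IsLocalRing.maximalIdeal S)
    {r t : S} (hr : r ∈ IsLocalRing.maximalIdeal S) (ht : t ∈ IsLocalRing.maximalIdeal S)
    (hreg : IsSMulRegular S r) : ¬ IsSMulRegular (QuotSMulTop r S) t := by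
  have hdiv : ∃ (n : ℕ) (z : S), y = r ^ n * z ∧ ¬ r ∣ z := by
    by_contra! hcon
    have hall : ∀ n : ℕ, r ^ n ∣ y := by
      intro n
      induction n with
      | zero => simp
      | succ n ih =>
        obtain ⟨z, hz⟩ := ih
        obtain ⟨w, rfl⟩ := hcon n z hz
        exact ⟨w, by rw [hz]; ring⟩
    have hmem : y ∈ ⨅ i : ℕ, (Ideal.span {r}) ^ i := by
      rw [Submodule.mem_iInf]
      intro n
      rw [Ideal.span_singleton_pow, Ideal.mem_span_singleton]
      exact hall n
    rw [Ideal.iInf_pow_eq_bot_of_isLocalRing _ (fun htop => (IsLocalRing.mem_maximalIdeal r).1 hr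
      (Ideal.span_singleton_eq_top.1 htop))] at hmem
    exact hy hmem
  obtain ⟨n, z, rfl, hz⟩ := hdiv
  intro htreg
  have hreg' : ∀ a, r * a = 0 → a = 0 := isSMulRegular_iff_right_eq_zero_of_smul.1 hreg
  have hregn : ∀ (n : ℕ) (a : S), r ^ n * a = 0 → a = 0 := by
    intro n
    induction n with
    | zero => simp
    | succ n ih =>
      intro a ha
      exact ih a (hreg' _ (by rw [← ha]; ring))
  have key : ∀ g : S, (Submodule.Quotient.mk g : QuotSMulTop r S) = 0 ↔ r ∣ g := by
    intro g
    rw [Submodule.Quotient.mk_eq_zero, Submodule.mem_smul_pointwise_iff_exists]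
    constructor
    · rintro ⟨k, -, rfl⟩; exact ⟨k, rfl⟩
    · rintro ⟨k, rfl⟩; exact ⟨k, trivial, rfl⟩
  obtain ⟨Q, hQ, hle⟩ := exists_le_isAssociatedPrime_of_isNoetherianRing S
    (Submodule.Quotient.mk z : QuotSMulTop r S) (fun h0 => hz ((key z).1 h0))
  have hmemQ : ∀ g, r ∣ g * z → g ∈ Q := fun g hg =>
    hle (Submodule.mem_colon_singleton.2 ((key (g * z)).2 hg))
  have hmax := h Q hQ.isPrime
    (fun g hg => hmemQ g (by rw [hregn n (g * z) (by rw [← hg]; ring)]; exact dvd_zero r))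
    r (hmemQ r (dvd_mul_right r z)) (fun h0 => hy (hreg' _ h0))
  obtain ⟨hprime, w, hw⟩ := isAssociatedPrime_iff.1 hQ
  have htw : t ∈ Q := hmax ▸ ht
  rw [hw, Submodule.mem_colon_singleton, Submodule.mem_bot] at htw
  have hw0 := isSMulRegular_iff_right_eq_zero_of_smul.1 htreg w htw
  exact hprime.ne_top (by rw [hw, hw0]; ext; simp)

variable {A : Type*} [CommRing A] [IsNoetherianRing A] {J P₀ P M : Ideal A} {y : A}

/-- An associated prime which is not minimal prevents unmixedness. -/
lemma Ideal.not_isUnmixed_of_colon (hP₀ : P₀.IsPrime) (hP : P.IsPrime) (hJ : J ≤ P₀)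
    (hlt : P₀ < P) (hy : ∀ g, g * y ∈ J ↔ g ∈ P) : ¬ J.IsUnmixed := by
  intro hun
  obtain ⟨Q, hQ, hQle⟩ := Ideal.exists_minimalPrimes_le hJ
  have hQ' : Q ∈ associatedPrimes A (A ⧸ J) := by
    apply Module.associatedPrimes.minimalPrimes_annihilator_subset_associatedPrimes
    rwa [Ideal.annihilator_quotient]
  have hP' : P ∈ associatedPrimes A (A ⧸ J) := by
    refine isAssociatedPrime_iff.2 ⟨hP, Ideal.Quotient.mk J y, ?_⟩
    ext g
    rw [Submodule.mem_colon_singleton, Submodule.mem_bot, ← hy, ← Ideal.Quotient.eq_zero_iff_mem,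
      map_mul]
    rfl
  have := hQ.1.1
  exact (Ideal.height_strict_mono_of_isPrime_of_isPrime (hQle.trans_lt hlt)).ne (hun Q hQ' P hP')

/-- If `P = J : y` is a prime which is covered by the maximal ideal `M` and not minimal over `J`,
then at `M` the ring `A ⧸ J` has dimension at least two and depth at most one. -/
lemma Ideal.not_isCohenMacaulay_of_colon (hP₀ : P₀.IsPrime) (hP : P.IsPrime) (hM : M.IsMaximal)
    (hJ : J ≤ P₀) (hlt : P₀ < P) (hPM : P < M)
    (hcov : ∀ Q : Ideal A, Q.IsPrime → P < Q → Q ≤ M → Q = M)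
    (hy : ∀ g, g * y ∈ J ↔ g ∈ P) : ¬ J.IsCohenMacaulay := by
  rintro ⟨-, hCM⟩
  let mk := Ideal.Quotient.mk J
  have hsurj : Function.Surjective mk := Ideal.Quotient.mk_surjective
  have hcm : ∀ I : Ideal A, J ≤ I → (I.map mk).comap mk = I := fun I hI => by
    rw [Ideal.comap_map_of_surjective' mk hsurj, Ideal.mk_ker, sup_eq_left]; exact hI
  have hprime : ∀ I : Ideal A, J ≤ I → I.IsPrime → (I.map mk).IsPrime := fun I hI hIp =>
    Ideal.map_isPrime_of_surjective hsurj (by rwa [Ideal.mk_ker])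
  have hstrict : ∀ I I' : Ideal A, J ≤ I → J ≤ I' → I < I' → I.map mk < I'.map mk := by
    intro I I' h h' hII
    refine lt_of_le_of_ne (Ideal.map_mono hII.le) fun heq => hII.ne ?_
    rw [← hcm I h, heq, hcm I' h']
  have hJP : J ≤ P := hJ.trans hlt.le
  have hJM : J ≤ M := hJP.trans hPM.le
  set m := M.map mk with hm
  have hmM : m.comap mk = M := hcm M hJM
  have : (P₀.map mk).IsPrime := hprime P₀ hJ hP₀
  have : (P.map mk).IsPrime := hprime P hJP hP
  have hmp : m.IsPrime := hprime M hJM hM.isPrime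
  have hmax : m.IsMaximal := (Ideal.map_eq_top_or_isMaximal_of_surjective mk hsurj hM).resolve_left
    hmp.ne_top
  have hheight : (2 : ℕ∞) ≤ m.height := by
    have h₁ := Ideal.height_add_one_le_of_lt_of_isPrime (hstrict P₀ P hJ hJP hlt)
    have h₂ := Ideal.height_add_one_le_of_lt_of_isPrime (hstrict P M hJP hJM hPM)
    calc (2 : ℕ∞) = 0 + 1 + 1 := by norm_num
      _ ≤ (P₀.map mk).height + 1 + 1 := by gcongr; exact zero_le
      _ ≤ (P.map mk).height + 1 := by gcongr
      _ ≤ m.height := h₂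
  have hdepth := hCM m
  rw [IsLocalization.AtPrime.ringKrullDim_eq_height m] at hdepth
  have hdepth' : IsLocalRing.depth (Localization.AtPrime m) = m.height := by exact_mod_cast hdepth
  rw [← hdepth'] at hheight
  have hex : ∃ rs : {rs : List (Localization.AtPrime m) //
      (∀ r ∈ rs, r ∈ IsLocalRing.maximalIdeal (Localization.AtPrime m)) ∧
        RingTheory.Sequence.IsRegular (Localization.AtPrime m) rs}, 2 ≤ rs.1.length := by
    by_contra! hcon
    have : IsLocalRing.depth (Localization.AtPrime m) ≤ 1 :=
      iSup_le fun rs => by exact_mod_cast Nat.le_of_lt_succ (hcon rs)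
    exact absurd (hheight.trans this) (by decide)
  obtain ⟨r, t, rs, hrs, hreg⟩ : ∃ r t rs, (∀ a ∈ r :: t :: rs,
      a ∈ IsLocalRing.maximalIdeal (Localization.AtPrime m)) ∧
        RingTheory.Sequence.IsRegular (Localization.AtPrime m) (r :: t :: rs) := by
    match hex with
    | ⟨⟨r :: t :: rs, h⟩, _⟩ => exact ⟨r, t, rs, h⟩
  rw [RingTheory.Sequence.isRegular_cons_iff, RingTheory.Sequence.isRegular_cons_iff] at hreg
  let loc := algebraMap (A ⧸ J) (Localization.AtPrime m)
  have hkill : ∀ g ∈ P, loc (mk g) * loc (mk y) = 0 := fun g hg => by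
    rw [← map_mul, ← map_mul, Ideal.Quotient.eq_zero_iff_mem.2 ((hy g).2 hg), map_zero]
  refine IsLocalRing.not_isSMulRegular_of_colon (y := loc (mk y)) ?_ ?_ (hrs r (by simp))
    (hrs t (by simp)) hreg.1 hreg.2.1
  · intro h0
    obtain ⟨⟨s, hs⟩, h0⟩ := (IsLocalization.map_eq_zero_iff m.primeCompl _ _).1 h0
    obtain ⟨s, rfl⟩ := hsurj s
    rw [← map_mul] at h0
    refine hs (Ideal.mem_map_of_mem mk (hPM.le ((hy s).1 (Ideal.Quotient.eq_zero_iff_mem.1 h0))))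
  · intro Q hQ hann r hrQ hry
    have hQ' : ((Q.comap loc).comap mk).IsPrime := Ideal.comap_isPrime mk _
    have hle : (Q.comap loc).comap mk ≤ M := by
      rw [← hmM]
      refine Ideal.comap_mono fun a ha => ?_
      exact (IsLocalization.AtPrime.to_map_mem_maximal_iff (Localization.AtPrime m) m a).1
        (IsLocalRing.le_maximalIdeal hQ.ne_top ha)
    have hPQ : P < (Q.comap loc).comap mk := by
      refine lt_of_le_of_ne (fun g hg => hann _ (hkill g hg)) fun heq => hry ?_
      obtain ⟨a, s, rfl⟩ := IsLocalization.exists_mk'_eq m.primeCompl r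
      obtain ⟨a, rfl⟩ := hsurj a
      have ha : a ∈ P := by
        rw [heq]
        exact IsLocalization.mk'_mem_iff.1 hrQ
      rw [IsLocalization.mk'_eq_mul_mk'_one, mul_right_comm, hkill a ha, zero_mul]
    have hQM := hcov _ hQ' hPQ hle
    refine le_antisymm (IsLocalRing.le_maximalIdeal hQ.ne_top) ?_
    rw [← Localization.AtPrime.map_eq_maximalIdeal, Ideal.map_le_iff_le_comap]
    exact Ideal.map_le_iff_le_comap.2 hQM.ge

end EmbeddedPrimes

/-! ### The ideal of a coordinate axis -/

section CoordinateAxis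

open MvPolynomial

variable {V K : Type*} [Field K]

/-- The ideal of a coordinate axis is covered by the ideal of the origin, as `K[X]` has
dimension one. -/
lemma MvPolynomial.eq_span_X_univ_of_lt (v : V) {Q : Ideal (MvPolynomial V K)} (hQ : Q.IsPrime)
    (hlt : Ideal.span (X '' {w | w ≠ v}) < Q) (hle : Q ≤ Ideal.span (X '' Set.univ)) :
    Q = Ideal.span (X '' Set.univ) := by
  classical
  let ρ : MvPolynomial V K →ₐ[K] Polynomial K := aeval fun w => if w ≠ v then 0 else Polynomial.X
  let σ : Polynomial K →ₐ[K] MvPolynomial V K := Polynomial.aeval (X v)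
  have hρσ : ∀ p, ρ (σ p) = p := by
    intro p
    have : ρ.comp σ = AlgHom.id K _ := Polynomial.algHom_ext (by simp [ρ, σ])
    exact AlgHom.congr_fun this p
  have hσρ : ∀ f, σ (ρ f) = aeval (fun w => if w ∈ {w | w ≠ v} then 0 else X w) f := by
    intro f
    have : σ.comp ρ = aeval (fun w => if w ∈ {w | w ≠ v} then 0 else X w) := by
      refine MvPolynomial.algHom_ext fun w => ?_
      by_cases hw : w = v <;> simp [ρ, σ, hw]
    exact AlgHom.congr_fun this f
  have hsurj : Function.Surjective ρ := fun p => ⟨_, hρσ p⟩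
  have hker : RingHom.ker ρ = Ideal.span (X '' {w | w ≠ v}) := by
    rw [← ker_aeval_ite]
    ext f
    rw [RingHom.mem_ker, RingHom.mem_ker, ← hσρ,
      map_eq_zero_iff σ (Function.LeftInverse.injective hρσ)]
  have hkerQ : RingHom.ker ρ ≤ Q := hker ▸ hlt.le
  have hprime : (Q.map ρ).IsPrime := Ideal.map_isPrime_of_surjective hsurj hkerQ
  have hne : Q.map ρ ≠ ⊥ := by
    rw [Ne, Ideal.map_eq_bot_iff_le_ker, hker]
    exact hlt.not_ge
  have hmax : (Q.map ρ).IsMaximal := Ideal.IsPrime.isMaximal hprime hne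
  have hQmax : Q.IsMaximal := by
    have := Ideal.comap_isMaximal_of_surjective ρ hsurj (K := Q.map ρ)
    rwa [Ideal.comap_map_of_surjective' ρ hsurj, sup_eq_left.2 hkerQ] at this
  exact hQmax.eq_of_le (isPrime_span_X_image _).ne_top hle

end CoordinateAxis

/-! ### Monomial ideals -/

section MonomialIdeals

open MvPolynomial

variable {V K : Type*} [Field K]

variable (K) in
/-- The monomial ideal spanned by the monomials whose exponents lie in `U`. -/
noncomputable def monomialIdeal (U : Set (V →₀ ℕ)) : Ideal (MvPolynomial V K) :=
  Ideal.span ((fun s => monomial s (1 : K)) '' U)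

lemma mem_monomialIdeal {U : Set (V →₀ ℕ)} (hU : IsUpperSet U) {f : MvPolynomial V K} :
    f ∈ monomialIdeal K U ↔ ∀ e ∈ f.support, e ∈ U := by
  rw [monomialIdeal, mem_ideal_span_monomial_image]
  exact forall₂_congr fun e _ => ⟨fun ⟨s, hs, hle⟩ => hU hle hs, fun h => ⟨e, h, le_rfl⟩⟩

lemma mul_monomial_mem_monomialIdeal {U : Set (V →₀ ℕ)} (hU : IsUpperSet U)
    {f : MvPolynomial V K} {s : V →₀ ℕ} :
    f * monomial s 1 ∈ monomialIdeal K U ↔ ∀ e ∈ f.support, e + s ∈ U := by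
  rw [mem_monomialIdeal hU]
  constructor
  · intro h e he
    refine h _ ?_
    rw [mem_support_iff, coeff_mul_monomial, mul_one]
    exact mem_support_iff.1 he
  · intro h e he
    rw [mem_support_iff, coeff_mul_monomial', mul_one] at he
    by_cases hs : s ≤ e
    · rw [if_pos hs] at he
      have := h _ (mem_support_iff.2 he)
      rwa [tsub_add_cancel_of_le hs] at this
    · simp [hs] at he

lemma monomialIdeal_sup_span_monomial (U : Set (V →₀ ℕ)) (s : V →₀ ℕ) :
    monomialIdeal K U ⊔ Ideal.span {monomial s 1} = monomialIdeal K (U ∪ {e | s ≤ e}) := by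
  rw [monomialIdeal, monomialIdeal, ← Ideal.span_union]
  apply le_antisymm <;> rw [Ideal.span_le]
  · rintro _ (⟨e, he, rfl⟩ | rfl)
    · exact Ideal.subset_span ⟨e, Or.inl he, rfl⟩
    · exact Ideal.subset_span ⟨s, Or.inr (le_refl s), rfl⟩
  · rintro _ ⟨e, he | he, rfl⟩
    · exact Ideal.subset_span (Or.inl ⟨e, he, rfl⟩)
    · have he : s ≤ e := he
      have : (monomial e 1 : MvPolynomial V K) = monomial (e - s) 1 * monomial s 1 := by
        rw [monomial_mul, mul_one, tsub_add_cancel_of_le he]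
      simp only [this]
      exact Ideal.mul_mem_left _ _ (Ideal.subset_span (Or.inr rfl))

end MonomialIdeals

/-! ### Monomial ideals supported on the 5-cycle -/

section FiveCycle

open MvPolynomial

variable {V K : Type*} [Field K]

/-- Exponent vectors, read off along the labelling `x`, that satisfy `R`. -/
def exponentSet (x : Fin 5 ≃ V) (R : (Fin 5 → ℕ) → Prop) : Set (V →₀ ℕ) :=
  {e | R fun i => e (x i)}

lemma isUpperSet_exponentSet (x : Fin 5 ≃ V) {R : (Fin 5 → ℕ) → Prop} (hR : Monotone R) :
    IsUpperSet (exponentSet x R) :=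
  fun _ _ hle h => hR (fun i => hle (x i)) h

variable (K) in
/-- The monomial ideal with exponents satisfying `R` has a clean filtration by the minimal primes
of the 5-cycle. -/
def CleanExponents (x : Fin 5 ≃ V) (R : (Fin 5 → ℕ) → Prop) : Prop :=
  HasCleanFiltration (Set.range (coverIdeal K x)) (monomialIdeal K (exponentSet x R))

namespace CleanExponents

variable {x : Fin 5 ≃ V} {R R' R'' : (Fin 5 → ℕ) → Prop}

lemma congr (h : CleanExponents K x R) (hR : ∀ e, R' e ↔ R e) : CleanExponents K x R' := by
  rwa [show R' = R from funext fun e => propext (hR e)]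

/-- The exact sequence obtained from multiplication by the power `x i ^ n`. -/
lemma step (hR : Monotone R) (i : Fin 5) (n : ℕ) (h' : CleanExponents K x R')
    (h'' : CleanExponents K x R'') (hR' : ∀ e, R (e + Pi.single i n) ↔ R' e)
    (hR'' : ∀ e, (R e ∨ n ≤ e i) ↔ R'' e) : CleanExponents K x R := by
  classical
  have hU := isUpperSet_exponentSet x hR
  have hmono' : Monotone R' := fun a b hab h =>
    (hR' b).1 (hR (add_le_add_left hab _) ((hR' a).2 h))
  refine HasCleanFiltration.step (monomial (Finsupp.single (x i) n) 1) (fun f => ?_) h' ?_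
  · rw [mul_monomial_mem_monomialIdeal hU, mem_monomialIdeal (isUpperSet_exponentSet x hmono')]
    refine forall₂_congr fun e _ => ?_
    change R _ ↔ R' _
    rw [← hR']
    refine iff_of_eq (congrArg R (funext fun j => ?_))
    simp [Finsupp.single_apply, Pi.single_apply, eq_comm]
  · rw [monomialIdeal_sup_span_monomial]
    have : exponentSet x R ∪ {e | Finsupp.single (x i) n ≤ e} = exponentSet x R'' := by
      ext e
      simp only [exponentSet, Set.mem_union, Set.mem_ofPred_eq, Finsupp.single_le_iff, ← hR'']
    rw [this]
    exact h''

lemma coverIdeal (x : Fin 5 ≃ V) (k : Fin 5) :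
    CleanExponents K x fun e => ∃ j, (j ≠ k ∧ j ≠ k + 2) ∧ e j ≠ 0 := by
  refine HasCleanFiltration.of_mem ⟨k, ?_⟩
  ext f
  rw [_root_.coverIdeal, mem_ideal_span_X_image, mem_monomialIdeal]
  · refine forall₂_congr fun e _ => ?_
    simp only [exponentSet, Set.mem_ofPred_eq]
    rw [← x.exists_congr_right]
    simp
  · refine isUpperSet_exponentSet x fun a b hab ⟨j, hj, h⟩ => ⟨j, hj, fun h₀ => h ?_⟩
    exact Nat.le_zero.1 ((hab j).trans h₀.le)

lemma pow_first {i j l : Fin 5} (hij : i ≠ j) (hil : i ≠ l) {b c : ℕ}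
    (h : CleanExponents K x fun e => 1 ≤ e i ∨ b ≤ e j ∨ c ≤ e l) (a : ℕ) :
    CleanExponents K x fun e => a + 1 ≤ e i ∨ b ≤ e j ∨ c ≤ e l := by
  induction a with
  | zero => exact h
  | succ a ih =>
    refine step (fun p q hpq h => ?_) i (a + 1) h ih (fun e => ?_) fun e => ?_
    · have := hpq i; have := hpq j; have := hpq l; simp only at *; omega
    · simp [hij.symm, hil.symm]; omega
    · omega

/-- Irreducible monomial ideals whose radical is a minimal prime of the 5-cycle. -/
lemma irreducible (x : Fin 5 ≃ V) (k i j l : Fin 5)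
    (hk : ∀ n, n ≠ k ∧ n ≠ k + 2 ↔ n = i ∨ n = j ∨ n = l)
    (hij : i ≠ j) (hil : i ≠ l) (hjl : j ≠ l) {a b c : ℕ} (ha : 0 < a) (hb : 0 < b) (hc : 0 < c) :
    CleanExponents K x fun e => a ≤ e i ∨ b ≤ e j ∨ c ≤ e l := by
  obtain ⟨a, rfl⟩ := Nat.exists_eq_add_of_lt ha
  obtain ⟨b, rfl⟩ := Nat.exists_eq_add_of_lt hb
  obtain ⟨c, rfl⟩ := Nat.exists_eq_add_of_lt hc
  simp only [zero_add]
  have h₀ : CleanExponents K x fun e => 1 ≤ e i ∨ 1 ≤ e j ∨ 1 ≤ e l := by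
    refine (coverIdeal x k).congr fun e => ?_
    simp [hk, Nat.one_le_iff_ne_zero]
  have h₁ := (pow_first hil.symm hjl.symm (h₀.congr fun e => by tauto) c :
    CleanExponents K x fun e => c + 1 ≤ e l ∨ 1 ≤ e i ∨ 1 ≤ e j)
  have h₂ := (pow_first hjl hij.symm (h₁.congr fun e => by tauto) b :
    CleanExponents K x fun e => b + 1 ≤ e j ∨ c + 1 ≤ e l ∨ 1 ≤ e i)
  exact pow_first hij hil (h₂.congr fun e => by tauto) a

/-- The five generators `x 0 ^ c₀ * x 1 ^ b₁`, `x 1 ^ a₁ * x 2 ^ c₂`, `x 2 ^ c₂ * x 3 ^ c₃`,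
`x 3 ^ c₃ * x 4 ^ b₄`, `x 4 ^ a₄ * x 0 ^ c₀`. Modulo `x 0 ^ c₀` they give the edge ideal of a path
with each variable replaced by a power. The colon ideal by `x 0 ^ c₀` contains `x 1 ^ b₁` and
`x 4 ^ a₄`; the hypothesis `h` makes the generator of the edge from `x 1` to `x 2`, or that of the
edge from `x 3` to `x 4`, redundant there. -/
lemma pentagon (x : Fin 5 ≃ V) {c₀ c₂ c₃ a₁ b₁ a₄ b₄ : ℕ} (h₀ : 0 < c₀) (h₂ : 0 < c₂) (h₃ : 0 < c₃)
    (ha₁ : 0 < a₁) (hb₁ : 0 < b₁) (ha₄ : 0 < a₄) (hb₄ : 0 < b₄) (h : b₁ ≤ a₁ ∨ a₄ ≤ b₄) :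
    CleanExponents K x fun e => (c₀ ≤ e 0 ∧ b₁ ≤ e 1) ∨ (a₁ ≤ e 1 ∧ c₂ ≤ e 2) ∨
      (c₂ ≤ e 2 ∧ c₃ ≤ e 3) ∨ (c₃ ≤ e 3 ∧ b₄ ≤ e 4) ∨ (a₄ ≤ e 4 ∧ c₀ ≤ e 0) := by
  have hpath : CleanExponents K x fun e => c₀ ≤ e 0 ∨ (a₁ ≤ e 1 ∧ c₂ ≤ e 2) ∨
      (c₂ ≤ e 2 ∧ c₃ ≤ e 3) ∨ (c₃ ≤ e 3 ∧ b₄ ≤ e 4) := by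
    have hP : CleanExponents K x fun e => c₀ ≤ e 0 ∨ c₂ ≤ e 2 ∨ (c₃ ≤ e 3 ∧ b₄ ≤ e 4) := by
      refine step (fun p q hpq h => ?_) 3 c₃
        (irreducible x 1 0 2 4 (by decide) (by decide) (by decide) (by decide) h₀ h₂ hb₄)
        (irreducible x 4 0 2 3 (by decide) (by decide) (by decide) (by decide) h₀ h₂ h₃)
        (fun e => ?_) fun e => ?_
      · have := hpq 0; have := hpq 2; have := hpq 3; have := hpq 4; simp only at *; omega
      · simp
      · omega
    refine step (fun p q hpq h => ?_) 2 c₂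
      (irreducible x 2 0 1 3 (by decide) (by decide) (by decide) (by decide) h₀ ha₁ h₃) hP
      (fun e => ?_) fun e => ?_
    · have := hpq 0; have := hpq 1; have := hpq 2; have := hpq 3; have := hpq 4
      simp only at *; omega
    · simp; omega
    · omega
  have hcolon : CleanExponents K x fun e => b₁ ≤ e 1 ∨ (a₁ ≤ e 1 ∧ c₂ ≤ e 2) ∨
      (c₂ ≤ e 2 ∧ c₃ ≤ e 3) ∨ (c₃ ≤ e 3 ∧ b₄ ≤ e 4) ∨ a₄ ≤ e 4 := by
    rcases h with h | h
    · refine step (fun p q hpq h => ?_) 3 c₃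
        (irreducible x 3 1 2 4 (by decide) (by decide) (by decide) (by decide) hb₁ h₂
          (lt_min ha₄ hb₄))
        (irreducible x 0 1 3 4 (by decide) (by decide) (by decide) (by decide) hb₁ h₃ ha₄)
        (fun e => ?_) fun e => ?_
      · have := hpq 1; have := hpq 2; have := hpq 3; have := hpq 4; simp only at *; omega
      · simp; omega
      · omega
    · refine step (fun p q hpq h => ?_) 2 c₂
        (irreducible x 0 1 3 4 (by decide) (by decide) (by decide) (by decide) (lt_min ha₁ hb₁) h₃
          ha₄)
        (irreducible x 3 1 2 4 (by decide) (by decide) (by decide) (by decide) hb₁ h₂ ha₄)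
        (fun e => ?_) fun e => ?_
      · have := hpq 1; have := hpq 2; have := hpq 3; have := hpq 4; simp only at *; omega
      · simp; omega
      · omega
  refine step (fun p q hpq h => ?_) 0 c₀ hcolon hpath (fun e => ?_) fun e => ?_
  · have := hpq 0; have := hpq 1; have := hpq 2; have := hpq 3; have := hpq 4
    simp only at *; omega
  · simp
  · omega

end CleanExponents

/-- If the annihilator of the monomial with exponents `s` modulo the ideal is the ideal of the
`x 0`-axis, then the ideal is neither unmixed nor Cohen–Macaulay. -/
lemma not_isUnmixed_and_not_isCohenMacaulay (x : Fin 5 ≃ V) {R : (Fin 5 → ℕ) → Prop}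
    (hR : Monotone R) (hcov : ∀ e, R e → ∃ j, (j ≠ 0 ∧ j ≠ 2) ∧ e j ≠ 0) (s : Fin 5 → ℕ)
    (hs : ∀ i, i ≠ 0 → R (Pi.single i 1 + s)) (hs' : ∀ n, ¬ R (Pi.single 0 n + s)) :
    ¬ (monomialIdeal K (exponentSet x R)).IsUnmixed ∧
      ¬ (monomialIdeal K (exponentSet x R)).IsCohenMacaulay := by
  classical
  have : Finite V := Finite.of_equiv _ x
  have hU := isUpperSet_exponentSet x hR
  let y : V →₀ ℕ := Finsupp.equivFunOnFinite.symm fun v => s (x.symm v)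
  have hyx : ∀ i, y (x i) = s i := fun i => by simp [y]
  have hJ : monomialIdeal K (exponentSet x R) ≤ coverIdeal K x 0 := by
    rw [monomialIdeal, Ideal.span_le]
    rintro _ ⟨e, he, rfl⟩
    obtain ⟨j, ⟨h₀, h₂⟩, hj⟩ := hcov _ he
    refine mem_ideal_span_X_image.2 fun m hm => ⟨x j, ⟨?_, ?_⟩, ?_⟩
    · simpa using h₀
    · simpa using h₂
    · rw [Finset.mem_singleton.1 (support_monomial_subset hm)]; exact hj
  have hcolon : ∀ g : MvPolynomial V K, g * monomial y 1 ∈ monomialIdeal K (exponentSet x R) ↔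
      g ∈ Ideal.span (X '' {w | w ≠ x 0}) := by
    intro g
    rw [mul_monomial_mem_monomialIdeal hU, mem_ideal_span_X_image]
    refine forall₂_congr fun e _ => ?_
    constructor
    · intro h
      by_contra! hcon
      refine hs' (e (x 0)) ?_
      change R _ at h
      convert h using 1
      funext i
      rcases eq_or_ne i 0 with rfl | hi
      · simp [hyx]
      · have := hcon (x i) (by simpa using hi)
        simp [hyx, hi, this]
    · rintro ⟨w, hw, h⟩
      obtain ⟨i, rfl⟩ := x.surjective w
      have hi : i ≠ 0 := by simpa using hw
      refine hR (fun j => ?_) (hs i hi)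
      rcases eq_or_ne j i with rfl | hj
      · simp [hyx]; omega
      · simp [hyx, hj]
  have hlt₁ : coverIdeal K x 0 < Ideal.span (X '' {w | w ≠ x 0}) := by
    refine lt_of_le_of_ne (Ideal.span_mono (Set.image_mono fun w hw => hw.1)) fun heq => ?_
    have : (X (x 2) : MvPolynomial V K) ∈ coverIdeal K x 0 := by
      rw [heq, X_mem_span_X_image]; simp
    rw [coverIdeal, X_mem_span_X_image] at this
    exact this.2 (by simp)
  have hlt₂ : (Ideal.span (X '' {w | w ≠ x 0}) : Ideal (MvPolynomial V K)) <
      Ideal.span (X '' Set.univ) := by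
    refine lt_of_le_of_ne (Ideal.span_mono (Set.image_mono fun w _ => trivial)) fun heq => ?_
    have : (X (x 0) : MvPolynomial V K) ∈ Ideal.span (X '' {w | w ≠ x 0}) := by
      rw [heq, X_mem_span_X_image]; trivial
    rw [X_mem_span_X_image] at this
    exact this rfl
  have hmax : (Ideal.span (X '' Set.univ) : Ideal (MvPolynomial V K)).IsMaximal := by
    have hker : RingHom.ker (constantCoeff : MvPolynomial V K →+* K) =
        Ideal.span (X '' Set.univ) := by
      ext f
      rw [RingHom.mem_ker, mem_ideal_span_X_image, constantCoeff_eq]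
      constructor
      · intro h e he
        by_contra! hcon
        rw [mem_support_iff] at he
        exact he (by rwa [show e = 0 from Finsupp.ext fun w => hcon w trivial])
      · intro h
        by_contra hcon
        obtain ⟨w, -, hw⟩ := h 0 (mem_support_iff.2 hcon)
        exact hw rfl
    rw [← hker]
    exact RingHom.ker_isMaximal_of_surjective _ fun a => ⟨C a, constantCoeff_C _ a⟩
  refine ⟨Ideal.not_isUnmixed_of_colon inferInstance (isPrime_span_X_image _) hJ hlt₁ hcolon,
    Ideal.not_isCohenMacaulay_of_colon inferInstance (isPrime_span_X_image _) hmax hJ hlt₁ hlt₂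
      (fun Q hQ h₁ h₂ => eq_span_X_univ_of_lt (x 0) hQ h₁ h₂) hcolon⟩

end FiveCycle

namespace WeightedOrientedGraph

/-! ### Weighted orientations of the 5-cycle -/

section Graph

variable {V : Type*} (D : WeightedOrientedGraph V)

/-- A flow-through vertex: it has weight at least two and an out-arc. When sources have weight
one, these are the vertices that occur with two different exponents in the generators of the edge
ideal. -/
def IsFlow (v : V) : Prop := D.weight v ≠ 1 ∧ ∃ u, D.Arc v u

/-- No two flow-through vertices are joined by an edge, and no two of them are
out-neighbours of the same vertex. -/
def FlowSeparated : Prop :=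
  (∀ u v, D.Arc u v → D.IsFlow u → ¬ D.IsFlow v) ∧
    ∀ t u v, u ≠ v → D.Arc t u → D.Arc t v → D.IsFlow u → ¬ D.IsFlow v

open Classical in
/-- The exponent of `v` in the generator of the edge ideal given by the edge between
`u` and `v`. -/
noncomputable def edgeExp (u v : V) : ℕ := if D.Arc u v then D.weight v else 1

variable {D}

lemma edgeExp_pos (D : WeightedOrientedGraph V) (u v : V) : 0 < D.edgeExp u v := by
  unfold edgeExp
  split_ifs
  exacts [D.weight_pos v, one_pos]

lemma edgeExp_of_arc {u v : V} (h : D.Arc u v) : D.edgeExp u v = D.weight v := if_pos h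

lemma edgeExp_of_arc' {u v : V} (h : D.Arc u v) : D.edgeExp v u = 1 := if_neg (D.asymm u v h)

lemma edgeExp_of_not_isFlow {u v : V} (hv : ¬ D.IsFlow v) (h : D.underlying.Adj u v) :
    D.edgeExp u v = D.weight v := by
  rcases h with h | h
  · exact edgeExp_of_arc h
  · rw [edgeExp_of_arc' h]
    by_contra hw
    exact hv ⟨Ne.symm hw, u, h⟩

lemma arc_of_not_arc {u v : V} (h : D.underlying.Adj u v) (h' : ¬ D.Arc u v) : D.Arc v u :=
  h.resolve_left h'

section Labelling

variable (x : SimpleGraph.cycleGraph 5 ≃g D.underlying)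

lemma adj_add_one (i : Fin 5) : D.underlying.Adj (x i) (x (i + 1)) :=
  x.map_rel_iff.2 (by revert i; decide)

lemma eq_or_eq_of_adj {i : Fin 5} {v : V} (h : D.underlying.Adj (x i) v) :
    v = x (i + 1) ∨ v = x (i + 4) := by
  obtain ⟨j, rfl⟩ := x.surjective v
  have h := x.map_rel_iff.1 h
  rw [x.injective.eq_iff, x.injective.eq_iff]
  exact (by decide : ∀ i j : Fin 5, (SimpleGraph.cycleGraph 5).Adj i j → j = i + 1 ∨ j = i + 4) i j h

/-- The rotation `i ↦ i + k` of the 5-cycle. -/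
def cycleRotate (k : Fin 5) : SimpleGraph.cycleGraph 5 ≃g SimpleGraph.cycleGraph 5 where
  toEquiv := Equiv.addRight k
  map_rel_iff' := by revert k; decide

/-- The reflection `i ↦ k - i` of the 5-cycle. -/
def cycleReflect (k : Fin 5) : SimpleGraph.cycleGraph 5 ≃g SimpleGraph.cycleGraph 5 where
  toEquiv := Equiv.subLeft k
  map_rel_iff' := by revert k; decide

lemma exists_labelling (x : SimpleGraph.cycleGraph 5 ≃g D.underlying)
    {u v : V} (h : D.underlying.Adj u v) :
    ∃ y : SimpleGraph.cycleGraph 5 ≃g D.underlying, y 0 = u ∧ y 1 = v := by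
  obtain ⟨i, rfl⟩ := x.surjective u
  rcases eq_or_eq_of_adj x h with rfl | rfl
  · refine ⟨(cycleRotate i).trans x, congrArg x ?_, congrArg x ?_⟩
    · change 0 + i = i
      rw [zero_add]
    · change 1 + i = i + 1
      rw [add_comm]
  · refine ⟨(cycleReflect i).trans x, congrArg x ?_, congrArg x ?_⟩
    · change i - 0 = i
      rw [sub_zero]
    · exact (by decide : ∀ i : Fin 5, i - 1 = i + 4) i

lemma exists_labelling' (x : SimpleGraph.cycleGraph 5 ≃g D.underlying)
    {u v : V} (h : D.underlying.Adj u v) :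
    ∃ y : SimpleGraph.cycleGraph 5 ≃g D.underlying, y 1 = u ∧ y 2 = v := by
  obtain ⟨y, rfl, rfl⟩ := exists_labelling x h
  exact ⟨(cycleRotate 4).trans y, rfl, rfl⟩

lemma IsFlow.arc_next {i : Fin 5} (h : D.IsFlow (x i)) (h' : ¬ D.Arc (x i) (x (i + 4))) :
    D.Arc (x i) (x (i + 1)) := by
  obtain ⟨-, u, hu⟩ := h
  rcases eq_or_eq_of_adj x (Or.inl hu) with rfl | rfl
  exacts [hu, absurd hu h']

lemma IsFlow.arc_prev {i : Fin 5} (h : D.IsFlow (x i)) (h' : ¬ D.Arc (x i) (x (i + 1))) :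
    D.Arc (x i) (x (i + 4)) := by
  obtain ⟨-, u, hu⟩ := h
  rcases eq_or_eq_of_adj x (Or.inl hu) with rfl | rfl
  exacts [absurd hu h', hu]

/-- A vertex of weight at least two is not a source, so it has an in-arc. -/
lemma arc_from_next (hsource : ∀ v, D.IsSource v → D.weight v = 1) {i : Fin 5}
    (hw : D.weight (x i) ≠ 1) (h : D.Arc (x i) (x (i + 4))) : D.Arc (x (i + 1)) (x i) := by
  refine arc_of_not_arc (adj_add_one x i) fun h' => hw (hsource _ ⟨⟨_, (adj_add_one x i).symm⟩, ?_⟩)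
  intro u hu
  rcases eq_or_eq_of_adj x hu.symm with rfl | rfl
  exacts [h', h]

lemma arc_from_prev (hsource : ∀ v, D.IsSource v → D.weight v = 1) {i : Fin 5}
    (hw : D.weight (x i) ≠ 1) (h : D.Arc (x i) (x (i + 1))) : D.Arc (x (i + 4)) (x i) := by
  by_contra h'
  refine hw (hsource _ ⟨⟨_, (adj_add_one x i).symm⟩, ?_⟩)
  intro u hu
  rcases eq_or_eq_of_adj x hu.symm with rfl | rfl
  exacts [h, arc_of_not_arc hu h']

/-- The configurations with an ideal that has a clean filtration: flow-through vertices occur only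
among the two neighbours of `x 0`, and `x 0` does not feed both. -/
def IsCleanLabelling : Prop :=
  ¬ D.IsFlow (x 0) ∧ ¬ D.IsFlow (x 2) ∧ ¬ D.IsFlow (x 3) ∧
    ¬ (D.Arc (x 0) (x 1) ∧ D.IsFlow (x 1) ∧ D.Arc (x 0) (x 4) ∧ D.IsFlow (x 4))

lemma FlowSeparated.not_isFlow_of_adj (h : D.FlowSeparated) {u v : V} (huv : D.underlying.Adj u v)
    (hu : D.IsFlow u) : ¬ D.IsFlow v :=
  fun hv => huv.elim (fun h' => h.1 u v h' hu hv) fun h' => h.1 v u h' hv hu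

lemma FlowSeparated.exists_isCleanLabelling (h : D.FlowSeparated)
    (x : SimpleGraph.cycleGraph 5 ≃g D.underlying) :
    ∃ y : SimpleGraph.cycleGraph 5 ≃g D.underlying, IsCleanLabelling y := by
  have hboth : ∀ y : SimpleGraph.cycleGraph 5 ≃g D.underlying,
      ¬ (D.Arc (y 0) (y 1) ∧ D.IsFlow (y 1) ∧ D.Arc (y 0) (y 4) ∧ D.IsFlow (y 4)) :=
    fun y ⟨h₁, hf₁, h₄, hf₄⟩ =>
      h.2 (y 0) (y 1) (y 4) (y.injective.ne (by decide)) h₁ h₄ hf₁ hf₄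
  by_cases hf : ∃ f, D.IsFlow f
  · obtain ⟨f, hf⟩ := hf
    obtain ⟨i, rfl⟩ := x.surjective f
    obtain ⟨y, hy, -⟩ := exists_labelling' x (adj_add_one x i)
    rw [← hy] at hf
    have h₀ := h.not_isFlow_of_adj (adj_add_one y 0).symm hf
    have h₂ := h.not_isFlow_of_adj (adj_add_one y 1) hf
    by_cases h₃ : D.IsFlow (y 3)
    · have h₄ := h.not_isFlow_of_adj (adj_add_one y 3) h₃
      exact ⟨(cycleRotate 2).trans y, h₂, h₄, h₀, hboth _⟩
    · exact ⟨y, h₀, h₂, h₃, hboth y⟩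
  · push Not at hf
    exact ⟨x, hf _, hf _, hf _, hboth x⟩

lemma isD2_or_isD3_of_isFlow (hsource : ∀ v, D.IsSource v → D.weight v = 1)
    (h₀ : D.weight (x 0) = 1) (h₁ : D.weight (x 1) = 1) (h₃ : D.IsFlow (x 3))
    (h₄ : D.IsFlow (x 4)) : D.IsD2 ∨ D.IsD3 := by
  by_cases h : D.Arc (x 3) (x 4)
  · have h40 : D.Arc (x 4) (x 0) := h₄.arc_next x (D.asymm _ _ h)
    have h23 : D.Arc (x 2) (x 3) := arc_from_prev x hsource h₃.1 h
    by_cases h₂ : D.weight (x 2) = 1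
    · exact Or.inl ⟨(cycleReflect 2).trans x, h23, h, h40, h₂, h₁, h₀, h₄.1, h₃.1⟩
    · have h12 : D.Arc (x 1) (x 2) := arc_from_prev x hsource h₂ h23
      exact Or.inr ⟨(cycleReflect 1).trans x, h12, h23, h, h₁, h₀, h₄.1, h₃.1, h₂⟩
  · have h43 := arc_of_not_arc (adj_add_one x 3) h
    have h32 : D.Arc (x 3) (x 2) := h₃.arc_prev x h
    have h04 : D.Arc (x 0) (x 4) := arc_from_next x hsource h₄.1 h43
    by_cases h₂ : D.weight (x 2) = 1
    · exact Or.inl ⟨x, h04, h43, h32, h₀, h₁, h₂, h₃.1, h₄.1⟩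
    · exact Or.inr ⟨x, h04, h43, h32, h₀, h₁, h₂, h₃.1, h₄.1⟩

lemma IsD4.exists_isCleanLabelling (h : D.IsD4) :
    ∃ y : SimpleGraph.cycleGraph 5 ≃g D.underlying, IsCleanLabelling y := by
  obtain ⟨x, h01, h12, h32, h34, h₀, -, -, h₃, -⟩ := h
  refine ⟨x, fun h => h.1 h₀, fun h => ?_, fun h => h.1 h₃, fun h => ?_⟩
  · exact D.asymm _ _ h32 (h.arc_next x (D.asymm _ _ h12))
  · exact D.asymm _ _ h.2.2.1 (h.2.2.2.arc_next x (D.asymm _ _ h34))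

lemma exists_isCleanLabelling_of_weight_one (hsource : ∀ v, D.IsSource v → D.weight v = 1)
    (x : SimpleGraph.cycleGraph 5 ≃g D.underlying)
    (h₀ : D.weight (x 0) = 1) (h₁ : D.weight (x 1) = 1) (hD : ¬ (D.IsD1 ∨ D.IsD2 ∨ D.IsD3)) :
    ∃ y : SimpleGraph.cycleGraph 5 ≃g D.underlying, IsCleanLabelling y := by
  rw [not_or] at hD
  have hf₀ : ¬ D.IsFlow (x 0) := fun h => h.1 h₀
  have hf₁ : ¬ D.IsFlow (x 1) := fun h => h.1 h₁
  by_cases h₃ : D.IsFlow (x 3)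
  · have h₄ : ¬ D.IsFlow (x 4) := fun h₄ => hD.2 (isD2_or_isD3_of_isFlow x hsource h₀ h₁ h₃ h₄)
    have h₂ : ¬ D.IsFlow (x 2) := fun h₂ => hD.2
      (isD2_or_isD3_of_isFlow ((cycleReflect 1).trans x) hsource h₁ h₀ h₃ h₂)
    exact ⟨(cycleRotate 2).trans x, h₂, h₄, hf₀, fun h => hf₁ h.2.2.2⟩
  · refine ⟨(cycleRotate 3).trans x, h₃, hf₀, hf₁, ?_⟩
    rintro ⟨h34 : D.Arc (x 3) (x 4), h₄ : D.IsFlow (x 4), h32 : D.Arc (x 3) (x 2),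
      h₂ : D.IsFlow (x 2)⟩
    have hw₃ : D.weight (x 3) = 1 := by
      by_contra hw
      exact h₃ ⟨hw, _, h34⟩
    exact hD.1 ⟨x, h32, h34, h₂.arc_prev x (D.asymm _ _ h32), h₄.arc_next x (D.asymm _ _ h34),
      h₀, h₁, h₂.1, hw₃, h₄.1⟩

lemma FlowSeparated.not_isD1_or_isD2_or_isD3 (h : D.FlowSeparated) :
    ¬ (D.IsD1 ∨ D.IsD2 ∨ D.IsD3) := by
  rintro (⟨x, h32, h34, h21, h40, -, -, h₂, -, h₄⟩ | ⟨x, -, h43, h32, -, -, -, h₃, h₄⟩ |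
    ⟨x, -, h43, h32, -, -, -, h₃, h₄⟩)
  · exact h.2 _ _ _ (x.injective.ne (by decide)) h32 h34 ⟨h₂, _, h21⟩ ⟨h₄, _, h40⟩
  · exact h.1 _ _ h43 ⟨h₄, _, h43⟩ ⟨h₃, _, h32⟩
  · exact h.1 _ _ h43 ⟨h₄, _, h43⟩ ⟨h₃, _, h32⟩

/-- If no edge has both weights one, the vertices of weight at least two form a vertex cover, so two
of them are adjacent; then the configuration is forced. -/
lemma FlowSeparated.isD4 (h : D.FlowSeparated) (hsource : ∀ v, D.IsSource v → D.weight v = 1)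
    (x : SimpleGraph.cycleGraph 5 ≃g D.underlying)
    (hw : ∀ u v, D.underlying.Adj u v → D.weight u = 1 → D.weight v ≠ 1) : D.IsD4 := by
  obtain ⟨i, hi, hi'⟩ : ∃ i, D.weight (x i) ≠ 1 ∧ D.weight (x (i + 1)) ≠ 1 := by
    by_contra! hcon
    have hodd : ∀ i, D.weight (x i) = 1 ↔ ¬ D.weight (x (i + 1)) = 1 := fun i =>
      ⟨fun h => hw _ _ (adj_add_one x i) h, fun h => by_contra fun h' => h (hcon i h')⟩
    have h₀ := hodd 0
    have h₁ := hodd 1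
    have h₂ := hodd 2
    have h₃ := hodd 3
    have h₄ : D.weight (x 4) = 1 ↔ ¬ D.weight (x 0) = 1 := hodd 4
    simp only [Fin.reduceAdd, zero_add] at h₀ h₁ h₂ h₃
    tauto
  obtain ⟨u, v, huv, hu, hv⟩ : ∃ u v, D.Arc u v ∧ D.weight u ≠ 1 ∧ D.weight v ≠ 1 :=
    (adj_add_one x i).elim (fun h => ⟨_, _, h, hi, hi'⟩) fun h => ⟨_, _, h, hi', hi⟩
  obtain ⟨y, rfl, rfl⟩ := exists_labelling' x (Or.inl huv)
  have h01 : D.Arc (y 0) (y 1) := arc_from_prev y hsource hu huv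
  have hf₁ : D.IsFlow (y 1) := ⟨hu, _, huv⟩
  have hf₂ : ¬ D.IsFlow (y 2) := h.1 _ _ huv hf₁
  have h32 : D.Arc (y 3) (y 2) := arc_of_not_arc (adj_add_one y 2) fun h' => hf₂ ⟨hv, _, h'⟩
  have hw₀ : D.weight (y 0) = 1 := by
    by_contra hw₀
    exact h.1 _ _ h01 ⟨hw₀, _, h01⟩ hf₁
  have hw₄ : D.weight (y 4) ≠ 1 := fun h₄ => hw _ _ (adj_add_one y 4) h₄ hw₀
  have hw₃ : D.weight (y 3) = 1 := by
    by_contra hw₃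
    have h43 : D.Arc (y 4) (y 3) := arc_from_next y hsource hw₃ h32
    exact h.1 _ _ h43 ⟨hw₄, _, h43⟩ ⟨hw₃, _, h32⟩
  refine ⟨y, h01, huv, h32, ?_, hw₀, hu, hv, hw₃, hw₄⟩
  by_contra h34
  have h43 := arc_of_not_arc (adj_add_one y 3) h34
  have h04 : D.Arc (y 0) (y 4) := arc_from_next y hsource hw₄ h43
  exact h.2 _ _ _ (y.injective.ne (by decide)) h01 h04 hf₁ ⟨hw₄, _, h43⟩

end Labelling

end Graph

/-! ### The edge ideal -/

section EdgeIdeal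

open MvPolynomial

variable {V K : Type*} [Field K] {D : WeightedOrientedGraph V}

/-- The exponents of the monomials in the edge ideal along a cyclic labelling `x`. -/
def edgeRel (x : SimpleGraph.cycleGraph 5 ≃g D.underlying) (e : Fin 5 → ℕ) : Prop :=
  (D.edgeExp (x 1) (x 0) ≤ e 0 ∧ D.edgeExp (x 0) (x 1) ≤ e 1) ∨
  (D.edgeExp (x 2) (x 1) ≤ e 1 ∧ D.edgeExp (x 1) (x 2) ≤ e 2) ∨
  (D.edgeExp (x 3) (x 2) ≤ e 2 ∧ D.edgeExp (x 2) (x 3) ≤ e 3) ∨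
  (D.edgeExp (x 4) (x 3) ≤ e 3 ∧ D.edgeExp (x 3) (x 4) ≤ e 4) ∨
  (D.edgeExp (x 0) (x 4) ≤ e 4 ∧ D.edgeExp (x 4) (x 0) ≤ e 0)

lemma monotone_edgeRel (x : SimpleGraph.cycleGraph 5 ≃g D.underlying) : Monotone (edgeRel x) := by
  intro p q hpq h
  replace hpq : ∀ i, p i ≤ q i := hpq
  have := hpq 0; have := hpq 1; have := hpq 2; have := hpq 3; have := hpq 4
  simp only [edgeRel] at h ⊢
  omega

lemma edgeRel_iff (x : SimpleGraph.cycleGraph 5 ≃g D.underlying) (e : V → ℕ) :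
    edgeRel x (fun i => e (x i)) ↔ ∃ a b, D.Arc a b ∧ 1 ≤ e a ∧ D.weight b ≤ e b := by
  constructor
  · have key : ∀ a b, D.underlying.Adj a b → D.edgeExp b a ≤ e a → D.edgeExp a b ≤ e b →
        ∃ a b, D.Arc a b ∧ 1 ≤ e a ∧ D.weight b ≤ e b := by
      rintro a b (h | h) ha hb
      · exact ⟨a, b, h, edgeExp_of_arc' h ▸ ha, edgeExp_of_arc h ▸ hb⟩
      · exact ⟨b, a, h, edgeExp_of_arc' h ▸ hb, edgeExp_of_arc h ▸ ha⟩
    rintro (h | h | h | h | h)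
    exacts [key _ _ (adj_add_one x 0) h.1 h.2, key _ _ (adj_add_one x 1) h.1 h.2,
      key _ _ (adj_add_one x 2) h.1 h.2, key _ _ (adj_add_one x 3) h.1 h.2,
      key _ _ (adj_add_one x 4) h.1 h.2]
  · rintro ⟨a, b, hab, ha, hb⟩
    rw [← edgeExp_of_arc' hab] at ha
    rw [← edgeExp_of_arc hab] at hb
    obtain ⟨i, rfl⟩ := x.surjective a
    rcases eq_or_eq_of_adj x (Or.inl hab) with rfl | rfl
    · unfold edgeRel
      revert ha hb
      fin_cases i <;>
        simp only [Fin.reduceAdd, Fin.reduceFinMk, Fin.zero_eta, zero_add, Fin.mk_one] <;> tauto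
    · unfold edgeRel
      revert ha hb
      fin_cases i <;>
        simp only [Fin.reduceAdd, Fin.reduceFinMk, Fin.zero_eta, zero_add, Fin.mk_one] <;> tauto

lemma edgeIdeal_eq_monomialIdeal (x : SimpleGraph.cycleGraph 5 ≃g D.underlying) :
    D.edgeIdeal K = monomialIdeal K (exponentSet x.toEquiv (edgeRel x)) := by
  classical
  have hmon : ∀ a b, (X a * X b ^ D.weight b : MvPolynomial V K) =
      monomial (Finsupp.single a 1 + Finsupp.single b (D.weight b)) 1 := by
    intro a b
    rw [X_pow_eq_monomial, X, monomial_mul, mul_one]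
  apply le_antisymm
  · rw [edgeIdeal, Ideal.span_le]
    rintro _ ⟨a, b, hab, rfl⟩
    refine Ideal.subset_span ⟨_, (edgeRel_iff x _).2 ⟨a, b, hab, ?_, ?_⟩, (hmon a b).symm⟩
    · simp
    · simp
  · rw [monomialIdeal, Ideal.span_le]
    rintro _ ⟨e, he, rfl⟩
    obtain ⟨a, b, hab, ha, hb⟩ := (edgeRel_iff x e).1 he
    have hne : a ≠ b := fun h => D.asymm a b hab (h ▸ h ▸ hab)
    have hle : Finsupp.single a 1 + Finsupp.single b (D.weight b) ≤ e := by
      intro v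
      rw [Finsupp.add_apply, Finsupp.single_apply, Finsupp.single_apply]
      split_ifs with h₁ h₂ h₂
      · exact absurd (h₁.trans h₂.symm) hne
      · exact h₁ ▸ ha
      · simpa using h₂ ▸ hb
      · simp
    have : (monomial e 1 : MvPolynomial V K) = monomial
        (e - (Finsupp.single a 1 + Finsupp.single b (D.weight b))) 1 * (X a * X b ^ D.weight b) := by
      rw [hmon, monomial_mul, mul_one, tsub_add_cancel_of_le hle]
    simp only [this]
    exact Ideal.mul_mem_left _ _ (Ideal.subset_span ⟨a, b, hab, rfl⟩)

lemma IsCleanLabelling.hasCleanFiltration {x : SimpleGraph.cycleGraph 5 ≃g D.underlying}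
    (h : IsCleanLabelling x) :
    HasCleanFiltration (Set.range (coverIdeal K x.toEquiv)) (D.edgeIdeal K) := by
  obtain ⟨h₀, h₂, h₃, hboth⟩ := h
  rw [edgeIdeal_eq_monomialIdeal x]
  refine (CleanExponents.pentagon (K := K) x.toEquiv (D.weight_pos (x 0)) (D.weight_pos (x 2))
    (D.weight_pos (x 3)) (D.edgeExp_pos (x 2) (x 1)) (D.edgeExp_pos (x 0) (x 1))
    (D.edgeExp_pos (x 0) (x 4)) (D.edgeExp_pos (x 3) (x 4)) ?_).congr fun e => ?_
  · by_contra! hcon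
    -- a larger exponent at an edge is the weight, on the side of the in-arc
    have key : ∀ {u v w : V}, D.underlying.Adj w v → D.edgeExp w v < D.edgeExp u v →
        D.Arc u v ∧ D.IsFlow v := by
      intro u v w hwv hlt
      have huv : D.Arc u v := by
        by_contra h'
        rw [edgeExp, edgeExp, if_neg h'] at hlt
        have := D.weight_pos v
        split_ifs at hlt <;> omega
      rw [edgeExp_of_arc huv] at hlt
      have hvw : D.Arc v w := arc_of_not_arc hwv fun h' => by
        rw [edgeExp_of_arc h'] at hlt; exact lt_irrefl _ hlt
      rw [edgeExp_of_arc' hvw] at hlt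
      exact ⟨huv, hlt.ne', w, hvw⟩
    obtain ⟨h01, hf₁⟩ := key (adj_add_one x 1).symm hcon.1
    obtain ⟨h04, hf₄⟩ := key (adj_add_one x 3) hcon.2
    exact hboth ⟨h01, hf₁, h04, hf₄⟩
  · have h10 : D.edgeExp (x 1) (x 0) = _ := edgeExp_of_not_isFlow h₀ (adj_add_one x 0).symm
    have h40 : D.edgeExp (x 4) (x 0) = _ := edgeExp_of_not_isFlow h₀ (adj_add_one x 4)
    have h12 : D.edgeExp (x 1) (x 2) = _ := edgeExp_of_not_isFlow h₂ (adj_add_one x 1)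
    have h32 : D.edgeExp (x 3) (x 2) = _ := edgeExp_of_not_isFlow h₂ (adj_add_one x 2).symm
    have h23 : D.edgeExp (x 2) (x 3) = _ := edgeExp_of_not_isFlow h₃ (adj_add_one x 2)
    have h43 : D.edgeExp (x 4) (x 3) = _ := edgeExp_of_not_isFlow h₃ (adj_add_one x 3).symm
    rw [edgeRel, h10, h40, h12, h32, h23, h43]

lemma edgeRel_cover (x : SimpleGraph.cycleGraph 5 ≃g D.underlying) (e : Fin 5 → ℕ)
    (h : edgeRel x e) : ∃ j, (j ≠ 0 ∧ j ≠ 2) ∧ e j ≠ 0 := by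
  have hpos := fun i j => D.edgeExp_pos (x i) (x j)
  rcases h with h | h | h | h | h
  · exact ⟨1, by decide, ((hpos 0 1).trans_le h.2).ne'⟩
  · exact ⟨1, by decide, ((hpos 2 1).trans_le h.1).ne'⟩
  · exact ⟨3, by decide, ((hpos 2 3).trans_le h.2).ne'⟩
  · exact ⟨3, by decide, ((hpos 4 3).trans_le h.1).ne'⟩
  · exact ⟨4, by decide, ((hpos 0 4).trans_le h.1).ne'⟩

/-- Two flow-through vertices `x 1`, `x 4` fed by `x 0`: an embedded prime is the annihilator of
`x₀ * x₁ ^ (w₁ - 1) * x₂ ^ (w₂ - 1) * x₃ ^ (w₃ - 1) * x₄ ^ (w₄ - 1)`. -/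
lemma not_isUnmixed_of_common_source (x : SimpleGraph.cycleGraph 5 ≃g D.underlying)
    (h01 : D.Arc (x 0) (x 1)) (h04 : D.Arc (x 0) (x 4)) (h12 : D.Arc (x 1) (x 2))
    (h43 : D.Arc (x 4) (x 3)) (hw₁ : D.weight (x 1) ≠ 1) (hw₄ : D.weight (x 4) ≠ 1) :
    ¬ (D.edgeIdeal K).IsUnmixed ∧ ¬ (D.edgeIdeal K).IsCohenMacaulay := by
  rw [edgeIdeal_eq_monomialIdeal x]
  have := D.weight_pos (x 1)
  have := D.weight_pos (x 2)
  have := D.weight_pos (x 3)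
  have := D.weight_pos (x 4)
  have h23 : (D.edgeExp (x 2) (x 3) = D.weight (x 3) ∨ D.edgeExp (x 3) (x 2) = D.weight (x 2)) :=
    (adj_add_one x 2).imp edgeExp_of_arc edgeExp_of_arc
  refine not_isUnmixed_and_not_isCohenMacaulay x.toEquiv (monotone_edgeRel x) (edgeRel_cover x)
    ![1, D.weight (x 1) - 1, D.weight (x 2) - 1, D.weight (x 3) - 1, D.weight (x 4) - 1] ?_ ?_
  · intro i hi
    rw [edgeRel, edgeExp_of_arc h01, edgeExp_of_arc' h01, edgeExp_of_arc h04, edgeExp_of_arc' h04,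
      edgeExp_of_arc h12, edgeExp_of_arc' h12, edgeExp_of_arc h43, edgeExp_of_arc' h43]
    fin_cases i <;> simp at hi ⊢ <;> omega
  · intro n
    rw [edgeRel, edgeExp_of_arc h01, edgeExp_of_arc' h01, edgeExp_of_arc h04, edgeExp_of_arc' h04,
      edgeExp_of_arc h12, edgeExp_of_arc' h12, edgeExp_of_arc h43, edgeExp_of_arc' h43]
    simp
    omega

/-- Two consecutive flow-through vertices `x 1`, `x 2`: an embedded prime is the annihilator of
`x₀ ^ w₀ * x₁ ^ (w₁ - 1) * x₂ ^ (w₂ - 1) * x₃ ^ (w₃ - 1) * x₄ ^ (ε - 1)`, where `ε` is the exponent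
of `x₄` in the generator of the edge to `x₀`. -/
lemma not_isUnmixed_of_consecutive (x : SimpleGraph.cycleGraph 5 ≃g D.underlying)
    (h01 : D.Arc (x 0) (x 1)) (h12 : D.Arc (x 1) (x 2)) (h23 : D.Arc (x 2) (x 3))
    (hw₁ : D.weight (x 1) ≠ 1) (hw₂ : D.weight (x 2) ≠ 1) :
    ¬ (D.edgeIdeal K).IsUnmixed ∧ ¬ (D.edgeIdeal K).IsCohenMacaulay := by
  rw [edgeIdeal_eq_monomialIdeal x]
  have := D.weight_pos (x 0)
  have := D.weight_pos (x 1)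
  have := D.weight_pos (x 2)
  have := D.weight_pos (x 3)
  have := D.edgeExp_pos (x 0) (x 4)
  have hle : ∀ u v, D.edgeExp u v ≤ D.weight v := fun u v => by
    have := D.weight_pos v
    unfold edgeExp
    split_ifs <;> omega
  have := hle (x 0) (x 4)
  have := hle (x 4) (x 0)
  have h34 : (D.edgeExp (x 3) (x 4) = D.weight (x 4) ∨ D.edgeExp (x 4) (x 3) = D.weight (x 3)) :=
    (adj_add_one x 3).imp edgeExp_of_arc edgeExp_of_arc
  refine not_isUnmixed_and_not_isCohenMacaulay x.toEquiv (monotone_edgeRel x) (edgeRel_cover x)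
    ![D.weight (x 0), D.weight (x 1) - 1, D.weight (x 2) - 1, D.weight (x 3) - 1,
      D.edgeExp (x 0) (x 4) - 1] ?_ ?_
  · intro i hi
    rw [edgeRel, edgeExp_of_arc h01, edgeExp_of_arc' h01,
      edgeExp_of_arc h12, edgeExp_of_arc' h12, edgeExp_of_arc h23, edgeExp_of_arc' h23]
    fin_cases i <;> simp at hi ⊢ <;> omega
  · intro n
    rw [edgeRel, edgeExp_of_arc h01, edgeExp_of_arc' h01,
      edgeExp_of_arc h12, edgeExp_of_arc' h12, edgeExp_of_arc h23, edgeExp_of_arc' h23]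
    simp
    omega

lemma not_isUnmixed_of_not_flowSeparated (hsource : ∀ v, D.IsSource v → D.weight v = 1)
    (x : SimpleGraph.cycleGraph 5 ≃g D.underlying) (h : ¬ D.FlowSeparated) :
    ¬ (D.edgeIdeal K).IsUnmixed ∧ ¬ (D.edgeIdeal K).IsCohenMacaulay := by
  rw [FlowSeparated, not_and_or] at h
  push Not at h
  rcases h with ⟨u, v, huv, hu, hv⟩ | ⟨t, u, v, hne, htu, htv, hu, hv⟩
  · obtain ⟨y, rfl, rfl⟩ := exists_labelling' x (Or.inl huv)
    exact not_isUnmixed_of_consecutive y (arc_from_prev y hsource hu.1 huv) huv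
      (hv.arc_next y (D.asymm _ _ huv)) hu.1 hv.1
  · obtain ⟨y, rfl, rfl⟩ := exists_labelling x (Or.inl htu)
    obtain rfl : v = y 4 := (eq_or_eq_of_adj y (Or.inl htv)).resolve_left hne.symm
    exact not_isUnmixed_of_common_source y htu htv (hu.arc_next y (D.asymm _ _ htu))
      (hv.arc_prev y (D.asymm _ _ htv)) hu.1 hv.1

/-- The edge ideal of the 5-cycle is that of the same oriented graph with all weights one, which
has no flow-through vertices. -/
lemma isCohenMacaulay_edgeIdeal_underlying (x : SimpleGraph.cycleGraph 5 ≃g D.underlying) :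
    (D.underlying.edgeIdeal K).IsCohenMacaulay := by
  let D₁ : WeightedOrientedGraph V := ⟨D.Arc, D.asymm, fun _ => 1, fun _ => one_pos⟩
  have hflow : ∀ v, ¬ D₁.IsFlow v := fun v h => h.1 rfl
  have heq : D.underlying.edgeIdeal K = D₁.edgeIdeal K := by
    rw [SimpleGraph.edgeIdeal, edgeIdeal]
    congr 1
    ext f
    constructor
    · rintro ⟨a, b, h | h, rfl⟩
      · exact ⟨a, b, h, by simp [D₁]⟩
      · exact ⟨b, a, h, by simp [D₁, mul_comm]⟩
    · rintro ⟨a, b, h, rfl⟩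
      exact ⟨a, b, Or.inl h, by simp [D₁]⟩
  have hclean : IsCleanLabelling (D := D₁) x :=
    ⟨hflow _, hflow _, hflow _, fun h => hflow _ h.2.1⟩
  rw [heq]
  exact hclean.hasCleanFiltration.isCohenMacaulay

end EdgeIdeal

end WeightedOrientedGraph

theorem theorem4p5 {K : Type*} [Field K] {V : Type*} (D : WeightedOrientedGraph V)
    (hC5 : Nonempty (D.underlying ≃g SimpleGraph.cycleGraph 5))
    (hsource : ∀ v, D.IsSource v → D.weight v = 1) :
    ((D.edgeIdeal K).IsCohenMacaulay ↔
      (D.IsD4 ∨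
        ((∃ x y, D.Arc x y ∧ D.weight x = 1 ∧ D.weight y = 1) ∧
          ¬ (D.IsD1 ∨ D.IsD2 ∨ D.IsD3)))) ∧
    ((D.edgeIdeal K).IsCohenMacaulay ↔
      (D.edgeIdeal K).IsUnmixed ∧ (D.underlying.edgeIdeal K).IsCohenMacaulay) := by
  obtain ⟨x⟩ := hC5
  replace x := x.symm
  have hbad := WeightedOrientedGraph.not_isUnmixed_of_not_flowSeparated (K := K) hsource x
  have hgood : D.FlowSeparated → (D.edgeIdeal K).IsCohenMacaulay ∧ (D.edgeIdeal K).IsUnmixed := by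
    intro h
    obtain ⟨y, hy⟩ := h.exists_isCleanLabelling x
    exact ⟨hy.hasCleanFiltration.isCohenMacaulay, hy.hasCleanFiltration.isUnmixed⟩
  have hsep : (D.edgeIdeal K).IsCohenMacaulay → D.FlowSeparated := fun h =>
    by_contra fun h' => (hbad h').2 h
  refine ⟨⟨fun h => ?_, fun h => ?_⟩, ⟨fun h => ?_, fun h => ?_⟩⟩
  · have hS := hsep h
    by_cases hw : ∃ x y, D.Arc x y ∧ D.weight x = 1 ∧ D.weight y = 1
    · exact Or.inr ⟨hw, hS.not_isD1_or_isD2_or_isD3⟩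
    · push Not at hw
      refine Or.inl (hS.isD4 hsource x fun u v huv hu hv => ?_)
      rcases huv with h' | h'
      exacts [hw _ _ h' hu hv, hw _ _ h' hv hu]
  · obtain ⟨y, hy⟩ : ∃ y : SimpleGraph.cycleGraph 5 ≃g D.underlying,
        WeightedOrientedGraph.IsCleanLabelling y := by
      rcases h with h | ⟨⟨u, v, huv, hu, hv⟩, hD⟩
      · exact h.exists_isCleanLabelling
      · obtain ⟨y, rfl, rfl⟩ := WeightedOrientedGraph.exists_labelling x (Or.inl huv)
        exact WeightedOrientedGraph.exists_isCleanLabelling_of_weight_one hsource y hu hv hD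
    exact hy.hasCleanFiltration.isCohenMacaulay
  · exact ⟨(hgood (hsep h)).2, WeightedOrientedGraph.isCohenMacaulay_edgeIdeal_underlying x⟩
  · exact (hgood (by_contra fun h' => (hbad h').1 h.1)).1
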